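/- Let $n,m$ be natural numbers and let $A,Q,\Sigma_0\in\mathbb R^{n\times n}$, $C\in\mathbb R^{m\times n}$, $R,Y\in\mathbb R^{m\times m}$ be real matrices with $Q,\Sigma_0,R,Y$ symmetric positive definite. Consider the linear system $$x_{k+1}=Ax_k+w_k,\qquad y_k=Cx_k+v_k,\qquad k\ge 0,$$ where $x_0\sim\mathcal N(0,\Sigma_0)$, $w_k\sim\mathcal N(0,Q)$, $v_k\sim\mathcal N(0,R)$, and let $\zeta_k$ be uniformly distributed on $[0,1]$; all the random variables $x_0$, $w_k$, $v_k$, $\zeta_k$ ($k\ge 0$) are mutually independent. Under the open-loop stochastic event trigger the sensor transmits $y_k$ if and only if $\zeta_k>\exp(-\tfrac12 y_k'Yy_k)$; put $\gamma_k=1$ in this case and $\gamma_k=0$ otherwise. Let $\mathcal I_k=\{\gamma_0,\dots,\gamma_k,\gamma_0y_0,\dots,\gamma_ky_k\}$, $\mathcal I_{-1}=\emptyset$, and define $$\hat x_k^-=\mathbb E[x_k\mid\mathcal I_{k-1}],\quad P_k^-=\mathbb E[(x_k-\hat x_k^-)(x_k-\hat x_k^-)'\mid\mathcal I_{k-1}],\quad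 \hat x_k=\mathbb E[x_k\mid\mathcal I_k],\quad P_k=\mathbb E[(x_k-\hat x_k)(x_k-\hat x_k)'\mid\mathcal I_k].$$ Then every $x_k$ is square-integrable and, for every $k\ge 0$, almost surely, the conditional distribution of $x_k$ given $\mathcal I_{k-1}$ is the Gaussian $\mathcal N(\hat x_k^-,P_k^-)$, and the conditional distribution of $x_k$ given $\mathcal I_k$ is the Gaussian $\mathcal N(\hat x_k,P_k)$. Moreover, almost surely, these quantities satisfy the recursion with initial condition $\hat x_0^-=0$, $P_0^-=\Sigma_0$, time update (for $k\ge1$) $$\hat x_k^-=A\hat x_{k-1},\qquad P_k^-=AP_{k-1}A'+Q,$$ and measurement update (for $k\ge 0$) $$\hat x_k=(I-K_kC)\hat x_k^-+\gamma_kK_ky_k,\qquad P_k=P_k^--K_kCP_k^-,\qquad K_k=P_k^-C'\bigl[CP_k^-C'+R+(1-\gamma_k)Y^{-1}\bigr]^{-1}.$$ -/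

import Mathlib

open MeasureTheory ProbabilityTheory
open scoped Matrix

namespace OLSET

noncomputable section

/-- The independent sources of randomness of the remote estimation problem: the initial state,
the process noises, the measurement noises and the random thresholds of the scheduler. -/
inductive Source where
  | init : Source
  | process (k : ℕ) : Source
  | measurement (k : ℕ) : Source
  | threshold (k : ℕ) : Source

/-- The σ-algebra generated by each source of randomness. -/
@[reducible] def sourceSigma {Ω : Type*} {n m : ℕ} (x₀ : Ω → EuclideanSpace ℝ (Fin n))
    (w : ℕ → Ω → EuclideanSpace ℝ (Fin n)) (v : ℕ → Ω → EuclideanSpace ℝ (Fin m))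
    (ζ : ℕ → Ω → ℝ) : Source → MeasurableSpace Ω
  | .init => MeasurableSpace.comap x₀ inferInstance
  | .process k => MeasurableSpace.comap (w k) inferInstance
  | .measurement k => MeasurableSpace.comap (v k) inferInstance
  | .threshold k => MeasurableSpace.comap (ζ k) inferInstance

/-- The idle probability `exp (-½ y' Y y)` of the open-loop trigger. -/
def idleProb {m : ℕ} (Y : Matrix (Fin m) (Fin m) ℝ) (y : EuclideanSpace ℝ (Fin m)) : ℝ :=
  Real.exp (-(1 / 2) * (y.ofLp ⬝ᵥ Y *ᵥ y.ofLp))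

/-- `info γ y k` is the data `(γ_j, γ_j y_j)`, `j < k`, available to the estimator just before
time `k`. The information available after time `k` is `info γ y (k + 1)`; `info γ y 0` is
constant, i.e. there is no information at the start. -/
def info {Ω : Type*} {m : ℕ} (γ : ℕ → Ω → ℝ) (y : ℕ → Ω → EuclideanSpace ℝ (Fin m)) (k : ℕ) :
    Ω → (Fin k → ℝ × EuclideanSpace ℝ (Fin m)) :=
  fun ω j ↦ (γ j ω, γ j ω • y j ω)

/-- The conditional mean `E[X | Z]`. -/
def condMean {Ω β : Type*} [MeasurableSpace Ω] [MeasurableSpace β] {n : ℕ} (P : Measure Ω)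
    (X : Ω → EuclideanSpace ℝ (Fin n)) (Z : Ω → β) : Ω → EuclideanSpace ℝ (Fin n) :=
  P[X | MeasurableSpace.comap Z inferInstance]

/-- The conditional error covariance `E[(X - E[X | Z]) (X - E[X | Z])' | Z]`, entrywise. -/
def condCov {Ω β : Type*} [MeasurableSpace Ω] [MeasurableSpace β] {n : ℕ} (P : Measure Ω)
    (X : Ω → EuclideanSpace ℝ (Fin n)) (Z : Ω → β) (ω : Ω) : Matrix (Fin n) (Fin n) ℝ :=
  Matrix.of fun i j ↦
    (P[fun ω' ↦ (X ω' i - condMean P X Z ω' i) * (X ω' j - condMean P X Z ω' j) |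
      MeasurableSpace.comap Z inferInstance]) ω

/-- `X` conditioned on `Z` is Gaussian with (random) mean `μ` and covariance `S`: almost surely,
the regular conditional distribution of `X` given `Z` is `𝒩(μ, S)`, with `S` a genuine covariance
matrix. -/
def IsCondGaussian {Ω β : Type*} [MeasurableSpace Ω] [MeasurableSpace β] {n : ℕ} (P : Measure Ω)
    [IsFiniteMeasure P] (X : Ω → EuclideanSpace ℝ (Fin n)) (Z : Ω → β)
    (μ : Ω → EuclideanSpace ℝ (Fin n)) (S : Ω → Matrix (Fin n) (Fin n) ℝ) : Prop :=
  ∀ᵐ ω ∂P, (S ω).PosSemidef ∧ condDistrib X Z P (Z ω) = multivariateGaussian (μ ω) (S ω)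

section Estimates

variable {Ω : Type*} [MeasurableSpace Ω] {n m : ℕ} (P : Measure Ω)
  (x : ℕ → Ω → EuclideanSpace ℝ (Fin n)) (γ : ℕ → Ω → ℝ) (y : ℕ → Ω → EuclideanSpace ℝ (Fin m))

/-- A priori MMSE estimate `E[x_k | I_{k-1}]`. -/
def priorMean (k : ℕ) : Ω → EuclideanSpace ℝ (Fin n) := condMean P (x k) (info γ y k)

/-- A priori error covariance. -/
def priorCov (k : ℕ) : Ω → Matrix (Fin n) (Fin n) ℝ := condCov P (x k) (info γ y k)

/-- A posteriori MMSE estimate `E[x_k | I_k]`. -/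
def postMean (k : ℕ) : Ω → EuclideanSpace ℝ (Fin n) := condMean P (x k) (info γ y (k + 1))

/-- A posteriori error covariance. -/
def postCov (k : ℕ) : Ω → Matrix (Fin n) (Fin n) ℝ := condCov P (x k) (info γ y (k + 1))

end Estimates

/-- The gain `S C' [C S C' + R + (1 - g) Y⁻¹]⁻¹` for prior covariance `S` and decision `g`. -/
def gain {n m : ℕ} (C : Matrix (Fin m) (Fin n) ℝ) (R Y : Matrix (Fin m) (Fin m) ℝ)
    (S : Matrix (Fin n) (Fin n) ℝ) (g : ℝ) : Matrix (Fin n) (Fin m) ℝ :=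
  S * Cᵀ * (C * S * Cᵀ + R + (1 - g) • Y⁻¹)⁻¹

end

end OLSET

/-!
The filter is a deterministic function of the received data: `priorMeanFilter`, `priorCovFilter`,
`postMeanFilter` and `postCovFilter` define it by the recursion of the theorem, and
`hasCondDistrib_state` shows by induction on time that the conditional law of the state is the
Gaussian with these parameters. Conditional means and covariances are integrals against the regular
conditional distribution (`condMean_ae_eq`, `condCov_ae_eq`), so they agree almost surely with the
filter, and the recursion holds by definition.

In the induction the process noise, the measurement noise and the threshold at time `k` are
independent of the past, so everything reduces to a fixed Gaussian prior `𝒩(a, S)`. The time update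
is the law of a linear image plus independent noise. For the measurement update, the regression
lemma `map_prod_observation_eq` (proved with characteristic functions) writes the state as
`x = K y + e`, where the residual `e` is Gaussian and independent of the observation
`y ∼ 𝒩(C a, T)`, `T = C S C' + R`. The decision depends on `y` and an independent threshold
only. Hence a transmitted `y` yields the Kalman update (`lintegral_transmit`). If the sensor is
idle, the law of `y` is multiplied by `exp (-½ y' Y y)` and normalized, which gives the Gaussian
with information matrix `T⁻¹ + Y` (`lintegral_idleProb_mul_multivariateGaussian`, by completing the
square in the density); averaging `K y + e` over this law and applying the matrix inversion lemma
yields the update with innovation covariance `T + Y⁻¹` (`lintegral_idle`).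

The covariance of the filter depends on the decisions only and takes finitely many values at each
time. It is therefore encoded as a `SimpleFunc`, which makes the measurability of the Gaussian
kernel immediate without any regularity of the matrix square root.
-/

namespace OLSET

open scoped RealInnerProductSpace ENNReal

/-! ### Affine images of independent Gaussian vectors -/

section AffineImages

variable {n m : ℕ}

theorem inner_toLp_mulVec (A : Matrix (Fin m) (Fin n) ℝ) (x : EuclideanSpace ℝ (Fin n))
    (s : EuclideanSpace ℝ (Fin m)) :
    ⟪WithLp.toLp 2 (A *ᵥ x.ofLp), s⟫ = ⟪x, WithLp.toLp 2 (Aᵀ *ᵥ s.ofLp)⟫ := by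
  simp only [EuclideanSpace.inner_eq_star_dotProduct, star_trivial]
  rw [Matrix.dotProduct_mulVec, ← Matrix.mulVec_transpose]

theorem inner_toLp_transpose_mulVec (A : Matrix (Fin m) (Fin n) ℝ) (x : EuclideanSpace ℝ (Fin n))
    (s : EuclideanSpace ℝ (Fin m)) :
    ⟪WithLp.toLp 2 (Aᵀ *ᵥ s.ofLp), x⟫ = ⟪s, WithLp.toLp 2 (A *ᵥ x.ofLp)⟫ := by
  rw [inner_toLp_mulVec, Matrix.transpose_transpose]

/-- Finite measures on a product of two Euclidean spaces are determined by their joint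
characteristic function. -/
theorem ext_of_integral_exp_inner_prod
    {μ ν : Measure (EuclideanSpace ℝ (Fin n) × EuclideanSpace ℝ (Fin m))}
    [IsFiniteMeasure μ] [IsFiniteMeasure ν]
    (h : ∀ s t, ∫ p, Complex.exp ((⟪p.1, s⟫ + ⟪p.2, t⟫ : ℝ) * Complex.I) ∂μ =
      ∫ p, Complex.exp ((⟪p.1, s⟫ + ⟪p.2, t⟫ : ℝ) * Complex.I) ∂ν) : μ = ν := by
  refine (MeasurableEquiv.toLp 2 (EuclideanSpace ℝ (Fin n) ×
    EuclideanSpace ℝ (Fin m))).map_measurableEquiv_injective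
      <| Measure.ext_of_charFun <| funext fun t ↦ ?_
  simp only [charFun_apply, integral_map_equiv]
  simpa only [MeasurableEquiv.coe_toLp, WithLp.prod_inner_apply] using h t.ofLp.1 t.ofLp.2

theorem integral_exp_inner_prod_multivariateGaussian
    {S : Matrix (Fin n) (Fin n) ℝ} {R : Matrix (Fin m) (Fin m) ℝ}
    (hS : S.PosSemidef) (hR : R.PosSemidef)
    (a s : EuclideanSpace ℝ (Fin n)) (b t : EuclideanSpace ℝ (Fin m)) :
    ∫ p, Complex.exp ((⟪p.1, s⟫ + ⟪p.2, t⟫ : ℝ) * Complex.I)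
        ∂((multivariateGaussian a S).prod (multivariateGaussian b R)) =
      Complex.exp ((⟪s, a⟫ + ⟪t, b⟫ : ℝ) * Complex.I -
        ((s.ofLp ⬝ᵥ S *ᵥ s.ofLp + t.ofLp ⬝ᵥ R *ᵥ t.ofLp : ℝ) : ℂ) / 2) := by
  have h := integral_prod_mul (μ := multivariateGaussian a S) (ν := multivariateGaussian b R)
    (fun x ↦ Complex.exp (⟪x, s⟫ * Complex.I)) (fun x ↦ Complex.exp (⟪x, t⟫ * Complex.I))
  rw [← charFun_apply, ← charFun_apply, charFun_multivariateGaussian hS,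
    charFun_multivariateGaussian hR, ← Complex.exp_add] at h
  simp only [← Complex.exp_add, ← add_mul] at h
  push_cast
  rw [h]
  congr 1
  ring

theorem map_mulVec_add_prod_multivariateGaussian
    {S : Matrix (Fin n) (Fin n) ℝ} {R : Matrix (Fin m) (Fin m) ℝ}
    (hS : S.PosSemidef) (hR : R.PosSemidef) (A : Matrix (Fin m) (Fin n) ℝ)
    (a : EuclideanSpace ℝ (Fin n)) (b : EuclideanSpace ℝ (Fin m)) :
    ((multivariateGaussian a S).prod (multivariateGaussian b R)).map
        (fun p ↦ WithLp.toLp 2 (A *ᵥ p.1.ofLp) + p.2) =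
      multivariateGaussian (WithLp.toLp 2 (A *ᵥ a.ofLp) + b) (A * S * Aᵀ + R) := by
  have hP : (A * S * Aᵀ + R).PosSemidef := (hS.mul_mul_conjTranspose_same A).add hR
  have hm : Measurable (fun p : EuclideanSpace ℝ (Fin n) × EuclideanSpace ℝ (Fin m) ↦
    WithLp.toLp 2 (A *ᵥ p.1.ofLp) + p.2) := by fun_prop
  have := Measure.isProbabilityMeasure_map
    (μ := (multivariateGaussian a S).prod (multivariateGaussian b R)) hm.aemeasurable
  refine Measure.ext_of_charFun (funext fun t ↦ ?_)
  rw [charFun_multivariateGaussian hP, charFun_apply, integral_map hm.aemeasurable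
    (by fun_prop)]
  simp only [inner_add_left, inner_toLp_mulVec]
  rw [integral_exp_inner_prod_multivariateGaussian hS hR]
  congr 3
  · rw [inner_add_right, inner_toLp_transpose_mulVec]
  · congr 1
    rw [Matrix.add_mulVec, dotProduct_add, Matrix.mul_assoc, ← Matrix.mulVec_mulVec,
      ← Matrix.mulVec_mulVec, Matrix.dotProduct_mulVec _ A, ← Matrix.mulVec_transpose]

theorem map_const_add_multivariateGaussian (b a : EuclideanSpace ℝ (Fin n))
    (S : Matrix (Fin n) (Fin n) ℝ) :
    (multivariateGaussian a S).map (fun x ↦ b + x) = multivariateGaussian (b + a) S := by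
  rw [multivariateGaussian, Measure.map_map (by fun_prop) (by fun_prop), multivariateGaussian]
  congr 1
  ext1 x
  simp [add_assoc]

/-- Gaussian regression: if `x ∼ 𝒩(a, S)` is observed through `y = C x + v` with independent
`v ∼ 𝒩(0, R)`, then `y ∼ 𝒩(C a, T)` with `T = C S C' + R`, and, as soon as `K T = S C'`, the
residual `x - K y` is Gaussian with covariance `S - K C S` and independent of `y`. -/
theorem map_prod_observation_eq
    {S : Matrix (Fin n) (Fin n) ℝ} {R T : Matrix (Fin m) (Fin m) ℝ}
    {C : Matrix (Fin m) (Fin n) ℝ} {K : Matrix (Fin n) (Fin m) ℝ}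
    (hS : S.PosSemidef) (hR : R.PosSemidef) (hT : T = C * S * Cᵀ + R) (hK : K * T = S * Cᵀ)
    (hV : (S - K * C * S).PosSemidef) (a : EuclideanSpace ℝ (Fin n)) :
    ((multivariateGaussian a S).prod (multivariateGaussian 0 R)).map
        (fun p ↦ (p.1, WithLp.toLp 2 (C *ᵥ p.1.ofLp) + p.2)) =
      ((multivariateGaussian (WithLp.toLp 2 (C *ᵥ a.ofLp)) T).prod
          (multivariateGaussian (WithLp.toLp 2 ((1 - K * C) *ᵥ a.ofLp)) (S - K * C * S))).map
        (fun p ↦ (WithLp.toLp 2 (K *ᵥ p.1.ofLp) + p.2, p.1)) := by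
  have hTp : T.PosSemidef := hT ▸ (hS.mul_mul_conjTranspose_same C).add hR
  have hSt : Sᵀ = S := hS.isHermitian
  have hTt : Tᵀ = T := hTp.isHermitian
  have hTK : T * Kᵀ = C * S := by
    have := congrArg Matrix.transpose hK
    simpa [Matrix.transpose_mul, hSt, hTt] using this
  have hm1 : Measurable (fun p : EuclideanSpace ℝ (Fin n) × EuclideanSpace ℝ (Fin m) ↦
    (p.1, WithLp.toLp 2 (C *ᵥ p.1.ofLp) + p.2)) := by fun_prop
  have hm2 : Measurable (fun p : EuclideanSpace ℝ (Fin m) × EuclideanSpace ℝ (Fin n) ↦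
    (WithLp.toLp 2 (K *ᵥ p.1.ofLp) + p.2, p.1)) := by
    fun_prop
  have := Measure.isProbabilityMeasure_map
    (μ := (multivariateGaussian a S).prod (multivariateGaussian 0 R)) hm1.aemeasurable
  have := Measure.isProbabilityMeasure_map
    (μ := (multivariateGaussian (WithLp.toLp 2 (C *ᵥ a.ofLp)) T).prod
      (multivariateGaussian (WithLp.toLp 2 ((1 - K * C) *ᵥ a.ofLp)) (S - K * C * S)))
    hm2.aemeasurable
  refine ext_of_integral_exp_inner_prod fun s t ↦ ?_
  rw [integral_map hm1.aemeasurable (by fun_prop), integral_map hm2.aemeasurable (by fun_prop)]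
  have e1 (p : EuclideanSpace ℝ (Fin n) × EuclideanSpace ℝ (Fin m)) :
      ⟪p.1, s⟫ + ⟪WithLp.toLp 2 (C *ᵥ p.1.ofLp) + p.2, t⟫ =
        ⟪p.1, s + WithLp.toLp 2 (Cᵀ *ᵥ t.ofLp)⟫ + ⟪p.2, t⟫ := by
    rw [inner_add_left, inner_add_right, inner_toLp_mulVec]; ring
  have e2 (p : EuclideanSpace ℝ (Fin m) × EuclideanSpace ℝ (Fin n)) :
      ⟪WithLp.toLp 2 (K *ᵥ p.1.ofLp) + p.2, s⟫ + ⟪p.1, t⟫ =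
        ⟪p.1, t + WithLp.toLp 2 (Kᵀ *ᵥ s.ofLp)⟫ + ⟪p.2, s⟫ := by
    rw [inner_add_left, inner_add_right, inner_toLp_mulVec]; ring
  simp only [e1, e2]
  rw [integral_exp_inner_prod_multivariateGaussian hS hR,
    integral_exp_inner_prod_multivariateGaussian hTp hV]
  have q1 : ⟪s + WithLp.toLp 2 (Cᵀ *ᵥ t.ofLp), a⟫ + ⟪t, (0 : EuclideanSpace ℝ (Fin m))⟫ =
      ⟪t + WithLp.toLp 2 (Kᵀ *ᵥ s.ofLp), WithLp.toLp 2 (C *ᵥ a.ofLp)⟫ +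
        ⟪s, WithLp.toLp 2 ((1 - K * C) *ᵥ a.ofLp)⟫ := by
    rw [inner_zero_right, inner_add_left, inner_add_left, inner_toLp_transpose_mulVec,
      inner_toLp_transpose_mulVec, Matrix.sub_mulVec, Matrix.one_mulVec, WithLp.toLp_sub,
      inner_sub_right, Matrix.mulVec_mulVec]
    ring
  have q2 : (s + WithLp.toLp 2 (Cᵀ *ᵥ t.ofLp)).ofLp ⬝ᵥ S *ᵥ
        (s + WithLp.toLp 2 (Cᵀ *ᵥ t.ofLp)).ofLp + t.ofLp ⬝ᵥ R *ᵥ t.ofLp =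
      (t + WithLp.toLp 2 (Kᵀ *ᵥ s.ofLp)).ofLp ⬝ᵥ T *ᵥ (t + WithLp.toLp 2 (Kᵀ *ᵥ s.ofLp)).ofLp +
        s.ofLp ⬝ᵥ (S - K * C * S) *ᵥ s.ofLp := by
    have hCt (u : Fin m → ℝ) (w : Fin n → ℝ) : (Cᵀ *ᵥ u) ⬝ᵥ w = u ⬝ᵥ (C *ᵥ w) := by
      rw [Matrix.mulVec_transpose, Matrix.dotProduct_mulVec]
    have hKt (u : Fin n → ℝ) (w : Fin m → ℝ) : (Kᵀ *ᵥ u) ⬝ᵥ w = u ⬝ᵥ (K *ᵥ w) := by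
      rw [Matrix.mulVec_transpose, Matrix.dotProduct_mulVec]
    simp only [WithLp.ofLp_add, Matrix.mulVec_add, dotProduct_add, add_dotProduct, hCt, hKt,
      Matrix.mulVec_mulVec, Matrix.sub_mulVec, dotProduct_sub, hTK, hK]
    rw [hT, Matrix.add_mulVec, dotProduct_add]
    simp only [Matrix.mul_assoc]
    ring
  rw [q1, q2]

end AffineImages

/-! ### Gaussian densities and exponential tilting -/

section Tilting

variable {m : ℕ}

/-- The standard Gaussian measure has density proportional to `exp (-‖x‖² / 2)`. -/
theorem exists_stdGaussian_eq_smul_withDensity :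
    ∃ c : ℝ≥0∞, stdGaussian (EuclideanSpace ℝ (Fin m)) =
      c • (volume : Measure (EuclideanSpace ℝ (Fin m))).withDensity
        (fun x ↦ ENNReal.ofReal (Real.exp (-(1 / 2) * ‖x‖ ^ 2))) := by
  have hb : 0 < (1 / 2 : ℂ).re := by norm_num
  have hexp (x : EuclideanSpace ℝ (Fin m)) : Complex.exp (-(1 / 2) * ‖x‖ ^ 2) =
      (Real.exp (-(1 / 2) * ‖x‖ ^ 2) : ℂ) := by push_cast; rfl
  have hi : Integrable (fun x : EuclideanSpace ℝ (Fin m) ↦ Real.exp (-(1 / 2) * ‖x‖ ^ 2)) := by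
    have := (GaussianFourier.integrable_cexp_neg_mul_sq_norm_add hb 0
      (0 : EuclideanSpace ℝ (Fin m))).re
    refine this.congr (.of_forall fun x ↦ ?_)
    simp only [zero_mul, add_zero, RCLike.re_eq_complex_re, hexp, Complex.ofReal_re]
  set ν := (volume : Measure (EuclideanSpace ℝ (Fin m))).withDensity
        (fun x ↦ ENNReal.ofReal (Real.exp (-(1 / 2) * ‖x‖ ^ 2))) with hν
  have hfin : IsFiniteMeasure ν := isFiniteMeasure_withDensity_ofReal hi.2
  have hcf (t : EuclideanSpace ℝ (Fin m)) : charFun ν t =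
      (Real.pi / (1 / 2) : ℂ) ^ (m / 2 : ℂ) * Complex.exp (-‖t‖ ^ 2 / 2) := by
    have h := GaussianFourier.integral_cexp_neg_mul_sq_norm_add hb Complex.I t
    rw [finrank_euclideanSpace_fin] at h
    rw [charFun_apply, integral_withDensity_eq_integral_toReal_smul (by fun_prop) (by simp)]
    convert! h using 2
    · ext x
      rw [ENNReal.toReal_ofReal (Real.exp_pos _).le, Complex.real_smul, ← hexp, ← Complex.exp_add,
        mul_comm Complex.I, real_inner_comm]
    · rw [Complex.I_sq]
      ring_nf
  have h0 := hcf 0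
  rw [charFun_zero] at h0
  simp only [norm_zero, Complex.ofReal_zero, ne_eq, OfNat.ofNat_ne_zero, not_false_eq_true,
    zero_pow, neg_zero, zero_div, Complex.exp_zero, mul_one] at h0
  have hne : ν.real Set.univ ≠ 0 := by
    intro h
    rw [h, Complex.ofReal_zero, eq_comm, Complex.cpow_eq_zero_iff] at h0
    have := h0.1
    simp at this
  have hne' : ν Set.univ ≠ 0 := fun h ↦ hne (by simp [Measure.real, h])
  refine ⟨(ν Set.univ)⁻¹, ?_⟩
  have : IsFiniteMeasure ((ν Set.univ)⁻¹ • ν) :=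
    Measure.smul_finite _ (ENNReal.inv_ne_top.2 hne')
  refine Measure.ext_of_charFun (funext fun t ↦ ?_)
  rw [charFun_stdGaussian, charFun_apply, integral_smul_measure, ← charFun_apply, hcf, ← h0,
    Complex.real_smul, ← mul_assoc, ENNReal.toReal_inv, ← Measure.real, ← Complex.ofReal_mul,
    inv_mul_cancel₀ hne, Complex.ofReal_one, one_mul]

open scoped MatrixOrder in
/-- A nondegenerate Gaussian measure has Lebesgue density proportional to
`exp (-(y - a)' T⁻¹ (y - a) / 2)`. -/
theorem exists_lintegral_multivariateGaussian_eq {T : Matrix (Fin m) (Fin m) ℝ} (hT : T.PosDef)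
    (a : EuclideanSpace ℝ (Fin m)) :
    ∃ c : ℝ≥0∞, ∀ f : EuclideanSpace ℝ (Fin m) → ℝ≥0∞, Measurable f →
      ∫⁻ y, f y ∂multivariateGaussian a T =
        c * ∫⁻ y, ENNReal.ofReal (Real.exp (-(1 / 2) *
          ((y - a).ofLp ⬝ᵥ T⁻¹ *ᵥ (y - a).ofLp))) * f y := by
  set L : Matrix (Fin m) (Fin m) ℝ := CFC.sqrt T with hL
  have hLL : L * L = T := by
    exact CFC.sqrt_mul_sqrt_self T hT.posSemidef.nonneg
  have hLu : IsUnit L := by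
    exact (CFC.isUnit_sqrt_iff T hT.posSemidef.nonneg).2 hT.isUnit
  have hLt : Lᵀ = L := by
    exact (CFC.sqrt_nonneg T).isSelfAdjoint
  have hLd : IsUnit L.det := (Matrix.isUnit_iff_isUnit_det _).1 hLu
  obtain ⟨c, hc⟩ := exists_stdGaussian_eq_smul_withDensity (m := m)
  have hdet : LinearMap.det (Matrix.toLpLin 2 2 L) ≠ 0 := by
    rw [Matrix.toLpLin_eq_toLin, LinearMap.det_toLin]
    exact hLd.ne_zero
  have hvol := Measure.map_linearMap_addHaar_eq_smul_addHaar
    (volume : Measure (EuclideanSpace ℝ (Fin m))) hdet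
  refine ⟨c * ENNReal.ofReal |(LinearMap.det (Matrix.toLpLin 2 2 L))⁻¹|, fun f hf ↦ ?_⟩
  set h : EuclideanSpace ℝ (Fin m) → ℝ≥0∞ := fun y ↦ ENNReal.ofReal (Real.exp (-(1 / 2) *
          ((y - a).ofLp ⬝ᵥ T⁻¹ *ᵥ (y - a).ofLp))) * f y with hh
  have hhm : Measurable h := by fun_prop
  have hquad (x : EuclideanSpace ℝ (Fin m)) :
      (L *ᵥ x.ofLp) ⬝ᵥ T⁻¹ *ᵥ (L *ᵥ x.ofLp) = ‖x‖ ^ 2 := by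
    have : L * (T⁻¹ * L) = 1 := by
      rw [← hLL, Matrix.mul_inv_rev, Matrix.mul_assoc, Matrix.nonsing_inv_mul _ hLd,
        Matrix.mul_one, Matrix.mul_nonsing_inv _ hLd]
    rw [Matrix.mulVec_mulVec, ← Matrix.vecMul_transpose, hLt, ← Matrix.dotProduct_mulVec,
      Matrix.mulVec_mulVec, this, Matrix.one_mulVec, ← real_inner_self_eq_norm_sq,
      EuclideanSpace.inner_eq_star_dotProduct, star_trivial]
  have hstep (x : EuclideanSpace ℝ (Fin m)) :
      ENNReal.ofReal (Real.exp (-(1 / 2) * ‖x‖ ^ 2)) *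
        f (a + Matrix.toLpLin 2 2 L x) = h (a + Matrix.toLpLin 2 2 L x) := by
    simp only [hh, add_sub_cancel_left, Matrix.toLpLin_apply, hquad]
  have hmeas : Measurable (Matrix.toLpLin 2 2 L) := by
    change Measurable fun x : EuclideanSpace ℝ (Fin m) ↦ WithLp.toLp 2 (L *ᵥ x.ofLp)
    fun_prop
  calc ∫⁻ y, f y ∂multivariateGaussian a T
      = ∫⁻ x, f (a + Matrix.toLpLin 2 2 L x) ∂stdGaussian _ := by
        rw [multivariateGaussian, lintegral_map hf (by fun_prop)]
        rfl
    _ = c * ∫⁻ x, h (a + Matrix.toLpLin 2 2 L x) := by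
        rw [hc, lintegral_smul_measure, lintegral_withDensity_eq_lintegral_mul _ (by fun_prop)
          (by fun_prop)]
        simp only [Pi.mul_apply, hstep, smul_eq_mul]
    _ = _ := by
        rw [← lintegral_map (f := fun y ↦ h (a + y)) (by fun_prop) hmeas, hvol,
          lintegral_smul_measure, lintegral_add_left_eq_self, smul_eq_mul, mul_assoc]

/-- Multiplying `𝒩(a, T)` by the idle probability `exp (-½ y' Y y)` and normalizing yields the
Gaussian with information matrix `T⁻¹ + Y` and information vector `T⁻¹ a`. -/
theorem lintegral_idleProb_mul_multivariateGaussian {T Y T' : Matrix (Fin m) (Fin m) ℝ}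
    (hT : T.PosDef) (hY : Y.PosDef) (hT' : T' = (T⁻¹ + Y)⁻¹) (a : EuclideanSpace ℝ (Fin m))
    {f : EuclideanSpace ℝ (Fin m) → ℝ≥0∞} (hf : Measurable f) :
    ∫⁻ y, ENNReal.ofReal (idleProb Y y) * f y ∂multivariateGaussian a T =
      (∫⁻ y, ENNReal.ofReal (idleProb Y y) ∂multivariateGaussian a T) *
        ∫⁻ y, f y ∂multivariateGaussian (WithLp.toLp 2 (T' *ᵥ (T⁻¹ *ᵥ a.ofLp))) T' := by
  have hJ : (T⁻¹ + Y).PosDef := hT.inv.add hY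
  have hT'p : T'.PosDef := hT' ▸ hJ.inv
  have hT'i : T'⁻¹ = T⁻¹ + Y := by
    rw [hT', Matrix.nonsing_inv_nonsing_inv _ ((Matrix.isUnit_iff_isUnit_det _).1 hJ.isUnit)]
  have hcancel : (T⁻¹ + Y) * T' = 1 := by
    rw [hT', Matrix.mul_nonsing_inv _ ((Matrix.isUnit_iff_isUnit_det _).1 hJ.isUnit)]
  have hJt : (T⁻¹ + Y)ᵀ = T⁻¹ + Y := hJ.isHermitian
  have hTit : (T⁻¹)ᵀ = T⁻¹ := hT.inv.isHermitian
  set b : EuclideanSpace ℝ (Fin m) := WithLp.toLp 2 (T' *ᵥ (T⁻¹ *ᵥ a.ofLp)) with hb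
  obtain ⟨c, hc⟩ := exists_lintegral_multivariateGaussian_eq hT a
  obtain ⟨c', hc'⟩ := exists_lintegral_multivariateGaussian_eq hT'p b
  have hφm : Measurable (idleProb Y) := by unfold idleProb; fun_prop
  -- completing the square
  have hsq (y : EuclideanSpace ℝ (Fin m)) :
      (y - a).ofLp ⬝ᵥ T⁻¹ *ᵥ (y - a).ofLp + y.ofLp ⬝ᵥ Y *ᵥ y.ofLp =
        (y - b).ofLp ⬝ᵥ T'⁻¹ *ᵥ (y - b).ofLp +
          (a.ofLp ⬝ᵥ T⁻¹ *ᵥ a.ofLp - b.ofLp ⬝ᵥ T⁻¹ *ᵥ a.ofLp) := by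
    have hJb : (T⁻¹ + Y) *ᵥ b.ofLp = T⁻¹ *ᵥ a.ofLp := by
      rw [hb, Matrix.mulVec_mulVec, hcancel, Matrix.one_mulVec]
    have h1 : b.ofLp ⬝ᵥ (T⁻¹ + Y) *ᵥ y.ofLp = y.ofLp ⬝ᵥ T⁻¹ *ᵥ a.ofLp := by
      rw [Matrix.dotProduct_mulVec, ← Matrix.mulVec_transpose, hJt, hJb, dotProduct_comm]
    have h2 : a.ofLp ⬝ᵥ T⁻¹ *ᵥ y.ofLp = y.ofLp ⬝ᵥ T⁻¹ *ᵥ a.ofLp := by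
      rw [Matrix.dotProduct_mulVec, ← Matrix.mulVec_transpose, hTit, dotProduct_comm]
    rw [hT'i]
    simp only [WithLp.ofLp_sub, Matrix.mulVec_sub, dotProduct_sub, sub_dotProduct, hJb, h1, h2]
    rw [Matrix.add_mulVec, dotProduct_add]
    ring
  set k : ℝ≥0∞ := ENNReal.ofReal (Real.exp (-(1 / 2) *
    (a.ofLp ⬝ᵥ T⁻¹ *ᵥ a.ofLp - b.ofLp ⬝ᵥ T⁻¹ *ᵥ a.ofLp))) with hk
  have hmul (y : EuclideanSpace ℝ (Fin m)) :
      ENNReal.ofReal (Real.exp (-(1 / 2) * ((y - a).ofLp ⬝ᵥ T⁻¹ *ᵥ (y - a).ofLp))) *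
        ENNReal.ofReal (idleProb Y y) =
      k * ENNReal.ofReal (Real.exp (-(1 / 2) * ((y - b).ofLp ⬝ᵥ T'⁻¹ *ᵥ (y - b).ofLp))) := by
    rw [hk, idleProb, ← ENNReal.ofReal_mul (Real.exp_pos _).le,
      ← ENNReal.ofReal_mul (Real.exp_pos _).le, ← Real.exp_add, ← Real.exp_add, ← mul_add,
      ← mul_add, hsq, add_comm]
  have key {g : EuclideanSpace ℝ (Fin m) → ℝ≥0∞} (hg : Measurable g) :
      ∫⁻ y, ENNReal.ofReal (idleProb Y y) * g y ∂multivariateGaussian a T =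
      c * (k * ∫⁻ y, ENNReal.ofReal (Real.exp (-(1 / 2) *
        ((y - b).ofLp ⬝ᵥ T'⁻¹ *ᵥ (y - b).ofLp))) * g y) := by
    rw [hc _ (by fun_prop), ← lintegral_const_mul k (by fun_prop)]
    congr 1
    refine lintegral_congr fun y ↦ ?_
    rw [← mul_assoc, hmul, mul_assoc]
  have hone := hc' (fun _ ↦ 1) measurable_const
  rw [lintegral_one, measure_univ] at hone
  have h1 := key (g := fun _ ↦ 1) measurable_const
  simp only [mul_one] at h1 hone
  rw [h1, key hf, hc' f hf]
  calc _ = c * (k * ((1 : ℝ≥0∞) * ∫⁻ y, ENNReal.ofReal (Real.exp (-(1 / 2) *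
        ((y - b).ofLp ⬝ᵥ T'⁻¹ *ᵥ (y - b).ofLp))) * f y)) := by rw [one_mul]
    _ = _ := by rw [hone]; ring

end Tilting

/-! ### The measurement update for a single Gaussian prior -/

section MeasurementUpdate

variable {n m : ℕ}

/-- The posterior mean `(I - K C) a + K u` for prior mean `a`, prior covariance `S`, decision `g`
and received value `u` (which is `0` when nothing is transmitted). -/
noncomputable def measMean (C : Matrix (Fin m) (Fin n) ℝ) (R Y : Matrix (Fin m) (Fin m) ℝ)
    (S : Matrix (Fin n) (Fin n) ℝ) (g : ℝ) (a : EuclideanSpace ℝ (Fin n))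
    (u : EuclideanSpace ℝ (Fin m)) : EuclideanSpace ℝ (Fin n) :=
  WithLp.toLp 2 ((1 - gain C R Y S g * C) *ᵥ a.ofLp + gain C R Y S g *ᵥ u.ofLp)

/-- The posterior covariance `S - K C S` for prior covariance `S` and decision `g`. -/
noncomputable def measCov (C : Matrix (Fin m) (Fin n) ℝ) (R Y : Matrix (Fin m) (Fin m) ℝ)
    (S : Matrix (Fin n) (Fin n) ℝ) (g : ℝ) : Matrix (Fin n) (Fin n) ℝ :=
  S - gain C R Y S g * C * S

variable {C : Matrix (Fin m) (Fin n) ℝ} {R Y : Matrix (Fin m) (Fin m) ℝ}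
  {S : Matrix (Fin n) (Fin n) ℝ}

/-- The Schur complement `S - S C' W⁻¹ C S` is positive semidefinite if `W ≥ C S C'`, by Joseph's
form `(I - K C) S (I - K C)' + K (W - C S C') K'` with `K = S C' W⁻¹`. -/
theorem posSemidef_sub_mul_inv_mul {W : Matrix (Fin m) (Fin m) ℝ} (hS : S.PosSemidef)
    (hW : W.PosDef) (hWS : (W - C * S * Cᵀ).PosSemidef) :
    (S - S * Cᵀ * W⁻¹ * C * S).PosSemidef := by
  have hu := (Matrix.isUnit_iff_isUnit_det _).1 hW.isUnit
  have hSt : Sᵀ = S := hS.isHermitian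
  have hWt : (W⁻¹)ᵀ = W⁻¹ := hW.inv.isHermitian
  set K := S * Cᵀ * W⁻¹ with hK
  have hKt : Kᵀ = W⁻¹ * (C * S) := by
    simp [hK, Matrix.transpose_mul, hSt, hWt]
  have hKW : K * (W * Kᵀ) = K * (C * S) := by
    rw [hKt, Matrix.mul_nonsing_inv_cancel_left _ _ hu]
  have hSK : S * (Cᵀ * Kᵀ) = K * (C * S) := by
    rw [hKt, hK]; simp only [Matrix.mul_assoc]
  have h := (hS.mul_mul_conjTranspose_same (1 - K * C)).add (hWS.mul_mul_conjTranspose_same K)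
  simp only [Matrix.conjTranspose_eq_transpose_of_trivial] at h
  convert! h using 1
  simp only [Matrix.transpose_sub, Matrix.transpose_one, Matrix.transpose_mul, Matrix.sub_mul,
    Matrix.mul_sub, Matrix.one_mul, Matrix.mul_one, Matrix.mul_assoc, hKW, hSK]
  abel

theorem posDef_innovation (hS : S.PosSemidef) (hR : R.PosDef) (hY : Y.PosDef) {g : ℝ}
    (hg : g ≤ 1) : (C * S * Cᵀ + R + (1 - g) • Y⁻¹).PosDef :=
  ((hR.posSemidef_add (hS.mul_mul_conjTranspose_same C))).add_posSemidef
    (hY.inv.posSemidef.smul (sub_nonneg.2 hg))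

theorem posSemidef_measCov (hS : S.PosSemidef) (hR : R.PosDef) (hY : Y.PosDef) {g : ℝ}
    (hg : g ≤ 1) : (measCov C R Y S g).PosSemidef := by
  refine posSemidef_sub_mul_inv_mul hS (posDef_innovation hS hR hY hg) ?_
  rw [add_assoc, add_sub_cancel_left]
  exact hR.posSemidef.add (hY.inv.posSemidef.smul (sub_nonneg.2 hg))

theorem gain_one_mul (hS : S.PosSemidef) (hR : R.PosDef) :
    gain C R Y S 1 * (C * S * Cᵀ + R) = S * Cᵀ := by
  have hT : (C * S * Cᵀ + R).PosDef := hR.posSemidef_add (hS.mul_mul_conjTranspose_same C)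
  rw [gain, sub_self, zero_smul, add_zero,
    Matrix.nonsing_inv_mul_cancel_right _ _ ((Matrix.isUnit_iff_isUnit_det _).1 hT.isUnit)]

/-- Disintegration of the joint law of a Gaussian state and its noisy observation along the
observation. -/
theorem lintegral_observation (hS : S.PosSemidef) (hR : R.PosDef) (hY : Y.PosDef)
    (a : EuclideanSpace ℝ (Fin n))
    {f : EuclideanSpace ℝ (Fin m) × EuclideanSpace ℝ (Fin n) → ℝ≥0∞} (hf : Measurable f) :
    ∫⁻ p, f (WithLp.toLp 2 (C *ᵥ p.1.ofLp) + p.2, p.1)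
        ∂((multivariateGaussian a S).prod (multivariateGaussian 0 R)) =
      ∫⁻ y, ∫⁻ e, f (y, WithLp.toLp 2 (gain C R Y S 1 *ᵥ y.ofLp) + e)
        ∂multivariateGaussian (WithLp.toLp 2 ((1 - gain C R Y S 1 * C) *ᵥ a.ofLp))
          (measCov C R Y S 1)
        ∂multivariateGaussian (WithLp.toLp 2 (C *ᵥ a.ofLp)) (C * S * Cᵀ + R) := by
  have h := map_prod_observation_eq (R := R) hS hR.posSemidef rfl
    (gain_one_mul (C := C) (Y := Y) hS hR) (posSemidef_measCov hS hR hY le_rfl) a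
  have h' := congrArg (fun μ ↦ ∫⁻ q, f (q.2, q.1) ∂μ) h
  simp only at h'
  rw [lintegral_map (by fun_prop) (by fun_prop), lintegral_map (by fun_prop) (by fun_prop)] at h'
  exact h'.trans (lintegral_prod _ (by fun_prop))

theorem lintegral_observation_right (hS : S.PosSemidef) (hR : R.PosDef)
    (a : EuclideanSpace ℝ (Fin n)) {f : EuclideanSpace ℝ (Fin m) → ℝ≥0∞} (hf : Measurable f) :
    ∫⁻ p, f (WithLp.toLp 2 (C *ᵥ p.1.ofLp) + p.2)
        ∂((multivariateGaussian a S).prod (multivariateGaussian 0 R)) =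
      ∫⁻ y, f y ∂multivariateGaussian (WithLp.toLp 2 (C *ᵥ a.ofLp)) (C * S * Cᵀ + R) := by
  have h := map_mulVec_add_prod_multivariateGaussian hS hR.posSemidef C a 0
  rw [add_zero] at h
  rw [← h, lintegral_map hf (by fun_prop)]

/-- Bayes' rule when the measurement is transmitted. -/
theorem lintegral_transmit (hS : S.PosSemidef) (hR : R.PosDef) (hY : Y.PosDef)
    (a : EuclideanSpace ℝ (Fin n))
    {f : EuclideanSpace ℝ (Fin m) × EuclideanSpace ℝ (Fin n) → ℝ≥0∞} (hf : Measurable f) :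
    ∫⁻ p, f (WithLp.toLp 2 (C *ᵥ p.1.ofLp) + p.2, p.1)
        ∂((multivariateGaussian a S).prod (multivariateGaussian 0 R)) =
      ∫⁻ p, ∫⁻ x, f (WithLp.toLp 2 (C *ᵥ p.1.ofLp) + p.2, x)
          ∂multivariateGaussian (measMean C R Y S 1 a (WithLp.toLp 2 (C *ᵥ p.1.ofLp) + p.2))
            (measCov C R Y S 1)
        ∂((multivariateGaussian a S).prod (multivariateGaussian 0 R)) := by
  have hmean (y : EuclideanSpace ℝ (Fin m)) :
      ∫⁻ x, f (y, x) ∂multivariateGaussian (measMean C R Y S 1 a y) (measCov C R Y S 1) =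
        ∫⁻ e, f (y, WithLp.toLp 2 (gain C R Y S 1 *ᵥ y.ofLp) + e)
          ∂multivariateGaussian (WithLp.toLp 2 ((1 - gain C R Y S 1 * C) *ᵥ a.ofLp))
            (measCov C R Y S 1) := by
    rw [measMean, WithLp.toLp_add, add_comm, ← map_const_add_multivariateGaussian,
      lintegral_map (by fun_prop) (by fun_prop)]
  simp only [hmean]
  rw [lintegral_observation hS hR hY a hf, lintegral_observation_right hS hR a
    (f := fun y ↦ ∫⁻ e, f (y, WithLp.toLp 2 (gain C R Y S 1 *ᵥ y.ofLp) + e)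
          ∂multivariateGaussian (WithLp.toLp 2 ((1 - gain C R Y S 1 * C) *ᵥ a.ofLp))
            (measCov C R Y S 1))]
  exact Measurable.lintegral_prod_right (by fun_prop)

/-- Bayes' rule when the sensor stays idle: the idle event only reweights the observation by
`exp (-½ y' Y y)`, which acts as the observation of the value `0` with additional noise of
covariance `Y⁻¹`. -/
theorem lintegral_idle (hS : S.PosSemidef) (hR : R.PosDef) (hY : Y.PosDef)
    (a : EuclideanSpace ℝ (Fin n)) {f : EuclideanSpace ℝ (Fin n) → ℝ≥0∞} (hf : Measurable f) :
    ∫⁻ p, ENNReal.ofReal (idleProb Y (WithLp.toLp 2 (C *ᵥ p.1.ofLp) + p.2)) * f p.1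
        ∂((multivariateGaussian a S).prod (multivariateGaussian 0 R)) =
      ∫⁻ p, ENNReal.ofReal (idleProb Y (WithLp.toLp 2 (C *ᵥ p.1.ofLp) + p.2)) *
          ∫⁻ x, f x ∂multivariateGaussian (measMean C R Y S 0 a 0) (measCov C R Y S 0)
        ∂((multivariateGaussian a S).prod (multivariateGaussian 0 R)) := by
  have hφm : Measurable (idleProb Y) := by unfold idleProb; fun_prop
  have hT : (C * S * Cᵀ + R).PosDef := hR.posSemidef_add (hS.mul_mul_conjTranspose_same C)
  have hK1 := gain_one_mul (C := C) (Y := Y) hS hR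
  have hV := posSemidef_measCov (C := C) hS hR hY le_rfl
  set T := C * S * Cᵀ + R with hTdef
  set K := gain C R Y S 1 with hK
  have hW : (T + Y⁻¹).PosDef := hT.add hY.inv
  have hTu := (Matrix.isUnit_iff_isUnit_det _).1 hT.isUnit
  have hYu := (Matrix.isUnit_iff_isUnit_det _).1 hY.isUnit
  have hWu := (Matrix.isUnit_iff_isUnit_det _).1 hW.isUnit
  have hSt : Sᵀ = S := hS.isHermitian
  have hTt : Tᵀ = T := hT.isHermitian
  have hTK : T * Kᵀ = C * S := by
    have := congrArg Matrix.transpose hK1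
    simpa [Matrix.transpose_mul, hSt, hTt] using this
  have hg0 : gain C R Y S 0 = K * T * (T + Y⁻¹)⁻¹ := by
    rw [gain, sub_zero, one_smul, hK1]
  -- the matrix inversion lemma
  have hT' : T - T * (T + Y⁻¹)⁻¹ * T = (T⁻¹ + Y)⁻¹ := by
    refine (Matrix.inv_eq_right_inv ?_).symm
    have h1 : 1 + Y * T = Y * (T + Y⁻¹) := by
      rw [Matrix.mul_add Y T, Matrix.mul_nonsing_inv _ hYu, add_comm]
    calc (T⁻¹ + Y) * (T - T * (T + Y⁻¹)⁻¹ * T)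
        = (T⁻¹ * T + Y * T) - (T⁻¹ * T + Y * T) * (T + Y⁻¹)⁻¹ * T := by noncomm_ring
      _ = 1 := by
        rw [Matrix.nonsing_inv_mul _ hTu, h1, Matrix.mul_nonsing_inv_cancel_right _ _ hWu, ← h1,
          add_sub_cancel_right]
  have hcov : K * (T - T * (T + Y⁻¹)⁻¹ * T) * Kᵀ + measCov C R Y S 1 = measCov C R Y S 0 := by
    have e : K * (T - T * (T + Y⁻¹)⁻¹ * T) * Kᵀ =
        K * (T * Kᵀ) - K * T * (T + Y⁻¹)⁻¹ * (T * Kᵀ) := by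
      simp only [Matrix.mul_sub, Matrix.sub_mul, Matrix.mul_assoc]
    rw [measCov, measCov, hg0, e, hTK, ← hK]
    simp only [Matrix.mul_assoc]
    abel
  have hmean : WithLp.toLp 2 (K *ᵥ ((T - T * (T + Y⁻¹)⁻¹ * T) *ᵥ (T⁻¹ *ᵥ (C *ᵥ a.ofLp)))) +
      WithLp.toLp 2 ((1 - K * C) *ᵥ a.ofLp) = measMean C R Y S 0 a 0 := by
    have e : K * (T - T * (T + Y⁻¹)⁻¹ * T) * T⁻¹ * C + (1 - K * C) =
        1 - K * T * (T + Y⁻¹)⁻¹ * C := by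
      have e' : K * (T - T * (T + Y⁻¹)⁻¹ * T) * T⁻¹ =
          K * (T * T⁻¹) - K * T * (T + Y⁻¹)⁻¹ * (T * T⁻¹) := by
        simp only [Matrix.mul_sub, Matrix.sub_mul, Matrix.mul_assoc]
      rw [e', Matrix.mul_nonsing_inv _ hTu, Matrix.mul_one, Matrix.mul_one, Matrix.sub_mul]
      abel
    rw [measMean, hg0, WithLp.ofLp_zero, Matrix.mulVec_zero, add_zero, ← e, Matrix.add_mulVec,
      WithLp.toLp_add]
    simp only [Matrix.mulVec_mulVec, Matrix.mul_assoc]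
  have hobs := lintegral_observation (C := C) hS hR hY a
    (f := fun q ↦ ENNReal.ofReal (idleProb Y q.1) * f q.2) (by fun_prop)
  rw [hobs, lintegral_observation_right hS hR a (f := fun y ↦ ENNReal.ofReal (idleProb Y y) * _)
    (by fun_prop), lintegral_mul_const _ (by fun_prop)]
  have hin (y : EuclideanSpace ℝ (Fin m)) := lintegral_const_mul
    (μ := multivariateGaussian (WithLp.toLp 2 ((1 - K * C) *ᵥ a.ofLp)) (measCov C R Y S 1))
    (ENNReal.ofReal (idleProb Y y)) (f := fun e ↦ f (WithLp.toLp 2 (K *ᵥ y.ofLp) + e))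
    (by fun_prop)
  simp only [← hK, ← hTdef, hin]
  rw [lintegral_idleProb_mul_multivariateGaussian hT hY hT' _
    (Measurable.lintegral_prod_right (by fun_prop)),
    ← lintegral_prod (μ := multivariateGaussian _ _)
      (f := fun p ↦ f (WithLp.toLp 2 (K *ᵥ p.1.ofLp) + p.2)) (by fun_prop),
    ← lintegral_map (g := fun p : EuclideanSpace ℝ (Fin m) × EuclideanSpace ℝ (Fin n) ↦
      WithLp.toLp 2 (K *ᵥ p.1.ofLp) + p.2) hf (by fun_prop),
    map_mulVec_add_prod_multivariateGaussian (hT' ▸ (hT.inv.add hY).inv.posSemidef) hV, hmean, hcov]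

end MeasurementUpdate

/-! ### Conditional laws under the time and measurement updates -/

section ConditionalLaws

variable {Ω β : Type*} [MeasurableSpace Ω] [MeasurableSpace β] {P : Measure Ω}
  [IsProbabilityMeasure P] {n m : ℕ}

/-- The Gaussian kernel `z ↦ 𝒩(M z, S z)`. The covariance is taken to be a simple function, which
is what happens in the filter, where it depends on the decisions only. -/
noncomputable def gaussianKernel (M : β → EuclideanSpace ℝ (Fin n)) (hM : Measurable M)
    (S : SimpleFunc β (Matrix (Fin n) (Fin n) ℝ)) : Kernel β (EuclideanSpace ℝ (Fin n)) where
  toFun z := multivariateGaussian (M z) (S z)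
  measurable' := by
    refine S.measurable_bind (fun s z ↦ multivariateGaussian (M z) s) fun s ↦ ?_
    refine Measure.measurable_of_measurable_coe _ fun A hA ↦ ?_
    have (z : β) : multivariateGaussian (M z) s A =
        multivariateGaussian 0 s (Prod.mk z ⁻¹' ((fun p : β × EuclideanSpace ℝ (Fin n) ↦
          M p.1 + p.2) ⁻¹' A)) := by
      conv_lhs => rw [← add_zero (M z), ← map_const_add_multivariateGaussian,
        Measure.map_apply (by fun_prop) hA]
      rfl
    simp only [this]
    exact measurable_measure_prodMk_left ((by fun_prop : Measurable _) hA)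

theorem gaussianKernel_apply (M : β → EuclideanSpace ℝ (Fin n)) (hM : Measurable M)
    (S : SimpleFunc β (Matrix (Fin n) (Fin n) ℝ)) (z : β) :
    gaussianKernel M hM S z = multivariateGaussian (M z) (S z) := rfl

instance (M : β → EuclideanSpace ℝ (Fin n)) (hM : Measurable M)
    (S : SimpleFunc β (Matrix (Fin n) (Fin n) ℝ)) : IsMarkovKernel (gaussianKernel M hM S) :=
  ⟨fun z ↦ by rw [gaussianKernel_apply]; infer_instance⟩

variable {κ : Kernel β (EuclideanSpace ℝ (Fin n))} [IsMarkovKernel κ]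
  {M : β → EuclideanSpace ℝ (Fin n)} {S : β → Matrix (Fin n) (Fin n) ℝ}
  {X : Ω → EuclideanSpace ℝ (Fin n)} {Z : Ω → β}

/-- Time update: if `X` given `Z` is `𝒩(M, S)` and `w ∼ 𝒩(0, Q)` is independent of `(Z, X)`, then
`A X + w` given `Z` is `𝒩(A M, A S A' + Q)`. -/
theorem hasCondDistrib_timeUpdate (h : HasCondDistrib X Z κ P)
    (hκ : ∀ z, κ z = multivariateGaussian (M z) (S z)) (hS : ∀ z, (S z).PosSemidef)
    {A Q : Matrix (Fin n) (Fin n) ℝ} (hQ : Q.PosSemidef) {w : Ω → EuclideanSpace ℝ (Fin n)}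
    (hw : HasLaw w (multivariateGaussian 0 Q) P) (hind : IndepFun (fun ω ↦ (Z ω, X ω)) w P)
    {κ' : Kernel β (EuclideanSpace ℝ (Fin n))} [IsMarkovKernel κ']
    (hκ' : ∀ z, κ' z = multivariateGaussian (WithLp.toLp 2 (A *ᵥ (M z).ofLp))
      (A * S z * Aᵀ + Q)) :
    HasCondDistrib (fun ω ↦ WithLp.toLp 2 (A *ᵥ (X ω).ofLp) + w ω) Z κ' P := by
  have hZX : AEMeasurable (fun ω ↦ (Z ω, X ω)) P := h.aemeasurable
  have hZ : AEMeasurable Z P := h.aemeasurable_fst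
  have hwm : AEMeasurable w P := hw.aemeasurable
  have hlaw : P.map (fun ω ↦ ((Z ω, X ω), w ω)) =
      (P.map Z ⊗ₘ κ).prod (multivariateGaussian 0 Q) := by
    rw [← h.map_eq, ← hw.map_eq]
    exact hind.map_prod_eq_prod_map_map hZX hwm
  have := Measure.isProbabilityMeasure_map (μ := P) hZ
  refine ⟨hZ.prodMk (((by fun_prop : Measurable fun x : EuclideanSpace ℝ (Fin n) ↦
    WithLp.toLp 2 (A *ᵥ x.ofLp)).comp_aemeasurable hZX.snd).add hwm), ?_⟩
  have hcomp : (fun ω ↦ (Z ω, WithLp.toLp 2 (A *ᵥ (X ω).ofLp) + w ω)) =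
      (fun q : (β × EuclideanSpace ℝ (Fin n)) × EuclideanSpace ℝ (Fin n) ↦
        (q.1.1, WithLp.toLp 2 (A *ᵥ q.1.2.ofLp) + q.2)) ∘ fun ω ↦ ((Z ω, X ω), w ω) := rfl
  rw [hcomp, ← AEMeasurable.map_map_of_aemeasurable (by fun_prop) (hZX.prodMk hwm), hlaw]
  refine Measure.ext_of_lintegral _ fun f hf ↦ ?_
  rw [lintegral_map hf (by fun_prop), lintegral_prod _ (by fun_prop),
    Measure.lintegral_compProd (Measurable.lintegral_prod_right (by fun_prop)),
    Measure.lintegral_compProd hf]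
  refine lintegral_congr fun z ↦ ?_
  have hmap := map_mulVec_add_prod_multivariateGaussian (hS z) hQ A (M z) 0
  rw [add_zero] at hmap
  rw [hκ, hκ', ← hmap, lintegral_map (by fun_prop) (by fun_prop), lintegral_prod _ (by fun_prop)]

/-- A uniform threshold exceeds `p ∈ [0, 1]` with probability `1 - p`. -/
theorem lintegral_threshold {p : ℝ} (h0 : 0 ≤ p) (h1 : p ≤ 1) (F : ℝ → ℝ≥0∞) :
    ∫⁻ t in Set.Icc (0 : ℝ) 1, F (if t ≤ p then 0 else 1) =
      ENNReal.ofReal p * F 0 + ENNReal.ofReal (1 - p) * F 1 := by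
  rw [← Set.Icc_union_Ioc_eq_Icc h0 h1, lintegral_union measurableSet_Ioc
    (Set.disjoint_left.2 fun t ht ht' ↦ ht.2.not_gt ht'.1)]
  rw [setLIntegral_congr_fun (g := fun _ ↦ F 0) measurableSet_Icc
      (fun t ht ↦ by simp only [if_pos ht.2]),
    setLIntegral_congr_fun (g := fun _ ↦ F 1) measurableSet_Ioc
      (fun t ht ↦ by simp only [if_neg ht.1.not_ge])]
  simp [mul_comm]

theorem idleProb_le_one {Y : Matrix (Fin m) (Fin m) ℝ} (hY : Y.PosSemidef)
    (y : EuclideanSpace ℝ (Fin m)) : idleProb Y y ≤ 1 := by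
  rw [idleProb, Real.exp_le_one_iff]
  have := hY.dotProduct_mulVec_nonneg y.ofLp
  simp only [star_trivial] at this
  linarith

/-- Measurement update: if `X` given `Z` is `𝒩(M, S)`, then `X` given `Z` and the output
`(γ, γ y)` of the open-loop trigger is Gaussian, with the updated mean and covariance. -/
theorem hasCondDistrib_measurementUpdate (h : HasCondDistrib X Z κ P)
    (hκ : ∀ z, κ z = multivariateGaussian (M z) (S z)) (hS : ∀ z, (S z).PosSemidef)
    {C : Matrix (Fin m) (Fin n) ℝ} {R Y : Matrix (Fin m) (Fin m) ℝ} (hR : R.PosDef)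
    (hY : Y.PosDef) {v y : Ω → EuclideanSpace ℝ (Fin m)} {ζ γ : Ω → ℝ}
    (hv : HasLaw v (multivariateGaussian 0 R) P)
    (hζ : HasLaw ζ (volume.restrict (Set.Icc (0 : ℝ) 1)) P)
    (hind : IndepFun (fun ω ↦ (Z ω, X ω)) (fun ω ↦ (v ω, ζ ω)) P) (hvζ : IndepFun v ζ P)
    (hy : ∀ ω, y ω = WithLp.toLp 2 (C *ᵥ (X ω).ofLp) + v ω)
    (hγ : ∀ ω, γ ω = if ζ ω ≤ idleProb Y (y ω) then 0 else 1)
    {κ' : Kernel (β × (ℝ × EuclideanSpace ℝ (Fin m))) (EuclideanSpace ℝ (Fin n))}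
    [IsMarkovKernel κ']
    (hκ' : ∀ z g u, g = 0 ∨ g = 1 → κ' (z, (g, u)) =
      multivariateGaussian (measMean C R Y (S z) g (M z) u) (measCov C R Y (S z) g)) :
    HasCondDistrib X (fun ω ↦ (Z ω, (γ ω, γ ω • y ω))) κ' P := by
  have hZX : AEMeasurable (fun ω ↦ (Z ω, X ω)) P := h.aemeasurable
  have hZ : AEMeasurable Z P := h.aemeasurable_fst
  have hvm : AEMeasurable v P := hv.aemeasurable
  have hζm : AEMeasurable ζ P := hζ.aemeasurable
  have := Measure.isProbabilityMeasure_map (μ := P) hZ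
  have hφm : Measurable (idleProb Y) := by unfold idleProb; fun_prop
  have hlaw : P.map (fun ω ↦ ((Z ω, X ω), (v ω, ζ ω))) =
      (P.map Z ⊗ₘ κ).prod
        ((multivariateGaussian 0 R).prod (volume.restrict (Set.Icc (0 : ℝ) 1))) := by
    rw [← h.map_eq, ← hv.map_eq, ← hζ.map_eq, ← hvζ.map_prod_eq_prod_map_map hvm hζm]
    exact hind.map_prod_eq_prod_map_map hZX (hvm.prodMk hζm)
  let obs : EuclideanSpace ℝ (Fin n) × EuclideanSpace ℝ (Fin m) → EuclideanSpace ℝ (Fin m) :=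
    fun p ↦ WithLp.toLp 2 (C *ᵥ p.1.ofLp) + p.2
  have hobs : Measurable obs := by fun_prop
  let dec : EuclideanSpace ℝ (Fin m) × ℝ → ℝ := fun q ↦ if q.2 ≤ idleProb Y q.1 then 0 else 1
  have hdec : Measurable dec :=
    Measurable.ite (measurableSet_le (by fun_prop) (by fun_prop)) (by fun_prop) (by fun_prop)
  let out : (β × EuclideanSpace ℝ (Fin n)) × (EuclideanSpace ℝ (Fin m) × ℝ) →
      (β × (ℝ × EuclideanSpace ℝ (Fin m))) × EuclideanSpace ℝ (Fin n) := fun q ↦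
    ((q.1.1, (dec (obs (q.1.2, q.2.1), q.2.2),
      dec (obs (q.1.2, q.2.1), q.2.2) • obs (q.1.2, q.2.1))), q.1.2)
  have hout : Measurable out := by fun_prop
  have hcomp : (fun ω ↦ ((Z ω, (γ ω, γ ω • y ω)), X ω)) =
      out ∘ fun ω ↦ ((Z ω, X ω), (v ω, ζ ω)) := by
    ext1 ω
    simp only [out, dec, obs, Function.comp_apply, hγ, hy]
  have hjoint : AEMeasurable (fun ω ↦ ((Z ω, (γ ω, γ ω • y ω)), X ω)) P :=
    hcomp ▸ hout.comp_aemeasurable (hZX.prodMk (hvm.prodMk hζm))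
  -- integrating out the threshold leaves the idle and the transmitting branch with their weights
  have hE (f : (β × (ℝ × EuclideanSpace ℝ (Fin m))) × EuclideanSpace ℝ (Fin n) → ℝ≥0∞)
      (hf : Measurable f) :
      ∫⁻ ω, f ((Z ω, (γ ω, γ ω • y ω)), X ω) ∂P =
        ∫⁻ z, ∫⁻ p, (ENNReal.ofReal (idleProb Y (obs p)) * f ((z, (0, 0)), p.1) +
          ENNReal.ofReal (1 - idleProb Y (obs p)) * f ((z, (1, obs p)), p.1))
          ∂((multivariateGaussian (M z) (S z)).prod (multivariateGaussian 0 R)) ∂(P.map Z) := by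
    rw [← lintegral_map' (f := f) hf.aemeasurable hjoint, hcomp,
      ← AEMeasurable.map_map_of_aemeasurable hout.aemeasurable (hZX.prodMk (hvm.prodMk hζm)),
      hlaw, lintegral_map hf hout, lintegral_prod _ (by fun_prop),
      Measure.lintegral_compProd (Measurable.lintegral_prod_right (by fun_prop))]
    refine lintegral_congr fun z ↦ ?_
    rw [hκ, lintegral_prod _ (by fun_prop)]
    refine lintegral_congr fun x ↦ ?_
    rw [lintegral_prod _ (by fun_prop)]
    refine lintegral_congr fun v ↦ ?_
    have h0 : 0 ≤ idleProb Y (obs (x, v)) := (Real.exp_pos _).le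
    have := lintegral_threshold h0 (idleProb_le_one hY.posSemidef (obs (x, v)))
      (fun g ↦ f ((z, (g, g • obs (x, v))), x))
    simp only [zero_smul, one_smul] at this
    exact this
  refine ⟨hjoint, ?_⟩
  refine Measure.ext_of_lintegral _ fun f hf ↦ ?_
  rw [lintegral_map' hf.aemeasurable hjoint, Measure.lintegral_compProd hf,
    lintegral_map' (Measurable.lintegral_kernel_prod_right' hf).aemeasurable hjoint.fst, hE f hf,
    hE (fun d ↦ ∫⁻ x, f (d.1, x) ∂κ' d.1)
      ((Measurable.lintegral_kernel_prod_right' hf).comp measurable_fst)]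
  refine lintegral_congr fun z ↦ ?_
  rw [lintegral_add_left (by fun_prop), lintegral_add_left
    (by dsimp only; fun_prop)]
  simp only [hκ' z 0 0 (.inl rfl), hκ' z 1 _ (.inr rfl)]
  congr 1
  · exact lintegral_idle (hS z) hR hY (M z) (f := fun x ↦ f ((z, (0, 0)), x)) (by fun_prop)
  · have := lintegral_transmit (C := C) (hS z) hR hY (M z)
      (f := fun q ↦ ENNReal.ofReal (1 - idleProb Y q.1) * f ((z, (1, q.1)), q.2)) (by fun_prop)
    refine this.trans (lintegral_congr fun p ↦ ?_)
    change ∫⁻ x, ENNReal.ofReal (1 - idleProb Y (obs p)) * f ((z, (1, obs p)), x)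
      ∂multivariateGaussian (measMean C R Y (S z) 1 (M z) (obs p)) (measCov C R Y (S z) 1) = _
    rw [lintegral_const_mul _ (by fun_prop)]

end ConditionalLaws

/-! ### Conditional moments -/

section ConditionalMoments

variable {Ω β : Type*} [MeasurableSpace Ω] [MeasurableSpace β] {P : Measure Ω}
  [IsProbabilityMeasure P] {n : ℕ}
  {κ : Kernel β (EuclideanSpace ℝ (Fin n))} [IsMarkovKernel κ]
  {M : β → EuclideanSpace ℝ (Fin n)} {S : β → Matrix (Fin n) (Fin n) ℝ}
  {X : Ω → EuclideanSpace ℝ (Fin n)} {Z : Ω → β}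

theorem condDistrib_ae_eq_multivariateGaussian (hX : Measurable X) (hZ : Measurable Z)
    (h : HasCondDistrib X Z κ P) (hκ : ∀ z, κ z = multivariateGaussian (M z) (S z)) :
    ∀ᵐ ω ∂P, condDistrib X Z P (Z ω) = multivariateGaussian (M (Z ω)) (S (Z ω)) := by
  filter_upwards [ae_of_ae_map hZ.aemeasurable
    (condDistrib_ae_eq_of_measure_eq_compProd Z hX.aemeasurable h.map_eq)] with ω hω
  rw [hω, hκ]

theorem condMean_ae_eq (hX : Measurable X) (hZ : Measurable Z) (hL : MemLp X 2 P)
    (h : HasCondDistrib X Z κ P) (hκ : ∀ z, κ z = multivariateGaussian (M z) (S z)) :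
    ∀ᵐ ω ∂P, condMean P X Z ω = M (Z ω) := by
  filter_upwards [condDistrib_ae_eq_multivariateGaussian hX hZ h hκ,
    condExp_ae_eq_integral_condDistrib' (μ := P) hZ (hL.integrable one_le_two)] with ω h1 h2
  rw [condMean, h2, h1, integral_id_multivariateGaussian]

theorem integral_apply_multivariateGaussian (a : EuclideanSpace ℝ (Fin n))
    (T : Matrix (Fin n) (Fin n) ℝ) (i : Fin n) : ∫ x, x i ∂multivariateGaussian a T = a i := by
  have := (EuclideanSpace.proj (𝕜 := ℝ) i).integral_comp_comm
    (IsGaussian.integrable_id (μ := multivariateGaussian a T))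
  simpa using this

theorem condCov_ae_eq (hX : Measurable X) (hZ : Measurable Z) (hL : MemLp X 2 P)
    (h : HasCondDistrib X Z κ P) (hκ : ∀ z, κ z = multivariateGaussian (M z) (S z))
    (hM : Measurable M) (hS : ∀ z, (S z).PosSemidef) :
    ∀ᵐ ω ∂P, condCov P X Z ω = S (Z ω) := by
  have hmean := condMean_ae_eq hX hZ hL h hκ
  have hcoord (i : Fin n) : MemLp (fun ω ↦ X ω i - M (Z ω) i) 2 P := by
    have h1 : MemLp (fun ω ↦ X ω - M (Z ω)) 2 P := by
      refine (hL.sub (hL.condExp (m := MeasurableSpace.comap Z inferInstance)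
        one_le_two)).ae_eq ?_
      filter_upwards [hmean] with ω hω
      rw [Pi.sub_apply, ← hω, condMean]
    exact (EuclideanSpace.proj (𝕜 := ℝ) i).comp_memLp' h1
  have hentry (i j : Fin n) : ∀ᵐ ω ∂P, condCov P X Z ω i j = S (Z ω) i j := by
    have hF : StronglyMeasurable (fun q : β × EuclideanSpace ℝ (Fin n) ↦
        (q.2 i - M q.1 i) * (q.2 j - M q.1 j)) := by
      apply Measurable.stronglyMeasurable
      fun_prop
    have hcongr : (fun ω ↦ (X ω i - condMean P X Z ω i) * (X ω j - condMean P X Z ω j)) =ᵐ[P]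
        fun ω ↦ (X ω i - M (Z ω) i) * (X ω j - M (Z ω) j) := by
      filter_upwards [hmean] with ω hω
      rw [hω]
    filter_upwards [condExp_congr_ae (m := MeasurableSpace.comap Z inferInstance) hcongr,
      condExp_prod_ae_eq_integral_condDistrib hZ hX.aemeasurable hF
        ((hcoord i).integrable_mul (hcoord j)),
      condDistrib_ae_eq_multivariateGaussian hX hZ h hκ] with ω h1 h2 h3
    rw [condCov, Matrix.of_apply, h1, h2, h3, ← covariance_eval_multivariateGaussian (hS _) i j
      (μ := M (Z ω)), covariance]
    simp only [integral_apply_multivariateGaussian]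
  filter_upwards [ae_all_iff.2 fun i ↦ ae_all_iff.2 (hentry i)] with ω hω
  exact Matrix.ext hω

theorem isCondGaussian_condMean_condCov (hX : Measurable X) (hZ : Measurable Z)
    (hL : MemLp X 2 P) (h : HasCondDistrib X Z κ P)
    (hκ : ∀ z, κ z = multivariateGaussian (M z) (S z)) (hM : Measurable M)
    (hS : ∀ z, (S z).PosSemidef) :
    IsCondGaussian P X Z (condMean P X Z) (condCov P X Z) := by
  filter_upwards [condMean_ae_eq hX hZ hL h hκ, condCov_ae_eq hX hZ hL h hκ hM hS,
    condDistrib_ae_eq_multivariateGaussian hX hZ h hκ] with ω h1 h2 h3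
  rw [h1, h2]
  exact ⟨hS _, h3⟩

end ConditionalMoments

/-! ### The filter as a deterministic function of the received data -/

section Filter

variable {n m : ℕ}

/-- The last trigger decision in a data record. Every nonzero value counts as `1`, so that the
function is simple and takes values in `{0, 1}` even on data that never occur. -/
noncomputable def lastDecision (m k : ℕ) :
    SimpleFunc (Fin (k + 1) → ℝ × EuclideanSpace ℝ (Fin m)) ℝ :=
  SimpleFunc.piecewise {z | (z (Fin.last k)).1 = 0}
    (measurableSet_eq_fun (by fun_prop) (by fun_prop)) (SimpleFunc.const _ 0)
    (SimpleFunc.const _ 1)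

theorem lastDecision_le_one (k : ℕ) (z : Fin (k + 1) → ℝ × EuclideanSpace ℝ (Fin m)) :
    lastDecision m k z ≤ 1 := by
  classical
  rw [lastDecision, SimpleFunc.piecewise_apply]
  split_ifs <;> simp

theorem lastDecision_eq {k : ℕ} {z : Fin (k + 1) → ℝ × EuclideanSpace ℝ (Fin m)}
    (h : (z (Fin.last k)).1 = 0 ∨ (z (Fin.last k)).1 = 1) :
    lastDecision m k z = (z (Fin.last k)).1 := by
  classical
  rw [lastDecision, SimpleFunc.piecewise_apply]
  rcases h with h | h <;> simp [h]

theorem measurable_init (k : ℕ) : Measurable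
    (Fin.init : (Fin (k + 1) → ℝ × EuclideanSpace ℝ (Fin m)) → _) :=
  measurable_pi_lambda _ fun _ ↦ measurable_pi_apply _

variable (A Q Sigma0 : Matrix (Fin n) (Fin n) ℝ) (C : Matrix (Fin m) (Fin n) ℝ)
  (R Y : Matrix (Fin m) (Fin m) ℝ)

theorem measurable_measMean {β : Type*} [MeasurableSpace β]
    (S : SimpleFunc β (Matrix (Fin n) (Fin n) ℝ)) (g : SimpleFunc β ℝ)
    {a : β → EuclideanSpace ℝ (Fin n)} (ha : Measurable a)
    {u : β → EuclideanSpace ℝ (Fin m)} (hu : Measurable u) :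
    Measurable fun z ↦ measMean C R Y (S z) (g z) (a z) (u z) := by
  refine (S.pair g).measurable_bind (fun p z ↦ measMean C R Y p.1 p.2 (a z) (u z)) fun p ↦ ?_
  unfold measMean
  fun_prop

/-- The a priori covariance at time `k` as a function of the data received before time `k`. -/
noncomputable def priorCovFilter :
    (k : ℕ) → SimpleFunc (Fin k → ℝ × EuclideanSpace ℝ (Fin m)) (Matrix (Fin n) (Fin n) ℝ)
  | 0 => SimpleFunc.const _ Sigma0
  | k + 1 => (((priorCovFilter k).comp Fin.init (measurable_init k)).pair
      (lastDecision m k)).map fun p ↦ A * measCov C R Y p.1 p.2 * Aᵀ + Q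

/-- The a posteriori covariance at time `k` as a function of the data received up to time `k`. -/
noncomputable def postCovFilter (k : ℕ) :
    SimpleFunc (Fin (k + 1) → ℝ × EuclideanSpace ℝ (Fin m)) (Matrix (Fin n) (Fin n) ℝ) :=
  (((priorCovFilter A Q Sigma0 C R Y k).comp Fin.init (measurable_init k)).pair
      (lastDecision m k)).map fun p ↦ measCov C R Y p.1 p.2

/-- The a priori mean at time `k` as a function of the data received before time `k`. -/
noncomputable def priorMeanFilter :
    (k : ℕ) → (Fin k → ℝ × EuclideanSpace ℝ (Fin m)) → EuclideanSpace ℝ (Fin n)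
  | 0 => fun _ ↦ 0
  | k + 1 => fun z ↦ WithLp.toLp 2 (A *ᵥ (measMean C R Y
      (priorCovFilter A Q Sigma0 C R Y k (Fin.init z)) (lastDecision m k z)
      (priorMeanFilter k (Fin.init z)) (z (Fin.last k)).2).ofLp)

/-- The a posteriori mean at time `k` as a function of the data received up to time `k`. -/
noncomputable def postMeanFilter (k : ℕ) (z : Fin (k + 1) → ℝ × EuclideanSpace ℝ (Fin m)) :
    EuclideanSpace ℝ (Fin n) :=
  measMean C R Y (priorCovFilter A Q Sigma0 C R Y k (Fin.init z)) (lastDecision m k z)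
    (priorMeanFilter A Q Sigma0 C R Y k (Fin.init z)) (z (Fin.last k)).2

theorem postCovFilter_apply (k : ℕ) (z : Fin (k + 1) → ℝ × EuclideanSpace ℝ (Fin m)) :
    postCovFilter A Q Sigma0 C R Y k z =
      measCov C R Y (priorCovFilter A Q Sigma0 C R Y k (Fin.init z)) (lastDecision m k z) := rfl

theorem measurable_postMeanFilter_of_prior (k : ℕ)
    (h : Measurable (priorMeanFilter A Q Sigma0 C R Y k)) :
    Measurable (postMeanFilter A Q Sigma0 C R Y k) := by
  have hu : Measurable fun z : Fin (k + 1) → ℝ × EuclideanSpace ℝ (Fin m) ↦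
    (z (Fin.last k)).2 := by fun_prop
  have := measurable_measMean C R Y
    ((priorCovFilter A Q Sigma0 C R Y k).comp Fin.init (measurable_init k)) (lastDecision m k)
    (h.comp (measurable_init k)) hu
  simp only [SimpleFunc.coe_comp, Function.comp_apply] at this
  unfold postMeanFilter
  exact this

theorem measurable_priorMeanFilter (k : ℕ) :
    Measurable (priorMeanFilter A Q Sigma0 C R Y k) := by
  induction k with
  | zero => exact measurable_const
  | succ k ih =>
    exact (by fun_prop : Measurable fun x : EuclideanSpace ℝ (Fin n) ↦
      WithLp.toLp 2 (A *ᵥ x.ofLp)).comp (measurable_postMeanFilter_of_prior A Q Sigma0 C R Y k ih)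

theorem measurable_postMeanFilter (k : ℕ) :
    Measurable (postMeanFilter A Q Sigma0 C R Y k) :=
  measurable_postMeanFilter_of_prior A Q Sigma0 C R Y k
    (measurable_priorMeanFilter A Q Sigma0 C R Y k)

variable {A Q Sigma0 C R Y}

theorem posSemidef_priorCovFilter (hQ : Q.PosDef) (hSigma0 : Sigma0.PosDef) (hR : R.PosDef)
    (hY : Y.PosDef) (k : ℕ) (z : Fin k → ℝ × EuclideanSpace ℝ (Fin m)) :
    (priorCovFilter A Q Sigma0 C R Y k z).PosSemidef := by
  induction k with
  | zero => exact hSigma0.posSemidef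
  | succ k ih =>
    exact ((posSemidef_measCov (ih _) hR hY
      (lastDecision_le_one k z)).mul_mul_conjTranspose_same A).add hQ.posSemidef

theorem posSemidef_postCovFilter (hQ : Q.PosDef) (hSigma0 : Sigma0.PosDef) (hR : R.PosDef)
    (hY : Y.PosDef) (k : ℕ) (z : Fin (k + 1) → ℝ × EuclideanSpace ℝ (Fin m)) :
    (postCovFilter A Q Sigma0 C R Y k z).PosSemidef :=
  posSemidef_measCov (posSemidef_priorCovFilter hQ hSigma0 hR hY k _) hR hY
    (lastDecision_le_one k z)

end Filter

/-! ### Measurability and independence of the past -/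

section Past

variable {Ω : Type*} {n m : ℕ}

theorem measurable_state [MeasurableSpace Ω] {A : Matrix (Fin n) (Fin n) ℝ}
    {x w : ℕ → Ω → EuclideanSpace ℝ (Fin n)}
    (hx : ∀ k ω, x (k + 1) ω = WithLp.toLp 2 (A *ᵥ (x k ω).ofLp) + w k ω)
    (hx0 : Measurable (x 0)) {k : ℕ} (hw : ∀ j < k, Measurable (w j)) : Measurable (x k) := by
  induction k with
  | zero => exact hx0
  | succ k ih =>
    have h1 := ih fun j hj ↦ hw j (hj.trans k.lt_succ_self)
    have h2 := hw k k.lt_succ_self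
    rw [funext (hx k)]
    fun_prop

theorem measurable_info [MeasurableSpace Ω] {C : Matrix (Fin m) (Fin n) ℝ}
    {Y : Matrix (Fin m) (Fin m) ℝ} {x : ℕ → Ω → EuclideanSpace ℝ (Fin n)}
    {y v : ℕ → Ω → EuclideanSpace ℝ (Fin m)} {ζ γ : ℕ → Ω → ℝ}
    (hy : ∀ k ω, y k ω = WithLp.toLp 2 (C *ᵥ (x k ω).ofLp) + v k ω)
    (hγ : ∀ k ω, γ k ω = if ζ k ω ≤ idleProb Y (y k ω) then 0 else 1) {l : ℕ}
    (hxm : ∀ j < l, Measurable (x j)) (hv : ∀ j < l, Measurable (v j))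
    (hζ : ∀ j < l, Measurable (ζ j)) : Measurable (info γ y l) := by
  refine measurable_pi_lambda _ fun j ↦ ?_
  have h1 := hxm j j.2
  have h2 := hv j j.2
  have h3 := hζ j j.2
  have hym : Measurable (y j) := by
    rw [funext (hy j)]
    fun_prop
  have hφm : Measurable (idleProb Y) := by unfold idleProb; fun_prop
  have hγm : Measurable (γ j) := by
    rw [funext (hγ j)]
    exact Measurable.ite (measurableSet_le h3 (hφm.comp hym)) measurable_const measurable_const
  exact hγm.prodMk (hγm.smul hym)

/-- The sources that determine the state at time `k` and the data received before time `l`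
(for `l ≤ k + 1`). -/
def history (k l : ℕ) : Set Source
  | .init => True
  | .process j => j < k
  | .measurement j => j < l
  | .threshold j => j < l

theorem indepFun_of_measurable_iSup {Ω' Ω'' : Type*} [MeasurableSpace Ω'] [MeasurableSpace Ω'']
    {mΩ : MeasurableSpace Ω} {P : Measure Ω} {σ : Source → MeasurableSpace Ω}
    (hσ : ∀ s, σ s ≤ mΩ) (h : iIndep σ P) {S T : Set Source} (hST : Disjoint S T)
    {f : Ω → Ω'} {g : Ω → Ω''} (hf : Measurable[⨆ s ∈ S, σ s] f)
    (hg : Measurable[⨆ s ∈ T, σ s] g) : IndepFun f g P :=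
  (IndepFun_iff_Indep _ _ _).2 (indep_of_indep_of_le_left (indep_of_indep_of_le_right
    (indep_iSup_of_disjoint hσ h hST) hg.comap_le) hf.comap_le)

end Past

/-! ### Conditional laws of the states -/

section States

variable {n m : ℕ}

theorem measurable_snoc (k : ℕ) :
    Measurable fun p : (Fin k → ℝ × EuclideanSpace ℝ (Fin m)) × (ℝ × EuclideanSpace ℝ (Fin m)) ↦
      (Fin.snoc p.1 p.2 : Fin (k + 1) → ℝ × EuclideanSpace ℝ (Fin m)) := by
  refine measurable_pi_lambda _ fun j ↦ ?_
  refine Fin.lastCases ?_ (fun i ↦ ?_) j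
  · simp only [Fin.snoc_last]
    fun_prop
  · simp only [Fin.snoc_castSucc]
    fun_prop

theorem init_info_succ {Ω : Type*} (γ : ℕ → Ω → ℝ) (y : ℕ → Ω → EuclideanSpace ℝ (Fin m)) (k : ℕ)
    (ω : Ω) : Fin.init (info γ y (k + 1) ω) = info γ y k ω := rfl

theorem info_succ {Ω : Type*} (γ : ℕ → Ω → ℝ) (y : ℕ → Ω → EuclideanSpace ℝ (Fin m)) (k : ℕ)
    (ω : Ω) : info γ y (k + 1) ω =
      (Fin.snoc (info γ y k ω) (γ k ω, γ k ω • y k ω) :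
        Fin (k + 1) → ℝ × EuclideanSpace ℝ (Fin m)) :=
  (Fin.snoc_init_self (info γ y (k + 1) ω)).symm

variable {Ω : Type*} [MeasurableSpace Ω] {P : Measure Ω}
  {A Q Sigma0 : Matrix (Fin n) (Fin n) ℝ} {C : Matrix (Fin m) (Fin n) ℝ}
  {R Y : Matrix (Fin m) (Fin m) ℝ}
  {x w : ℕ → Ω → EuclideanSpace ℝ (Fin n)} {y v : ℕ → Ω → EuclideanSpace ℝ (Fin m)}
  {ζ γ : ℕ → Ω → ℝ}

/-- Given the data received before time `k`, and given the data received up to time `k`, the state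
at time `k` is Gaussian with the mean and covariance of the filter. -/
theorem hasCondDistrib_state [IsProbabilityMeasure P]
    (hQ : Q.PosDef) (hSigma0 : Sigma0.PosDef) (hR : R.PosDef) (hY : Y.PosDef)
    (hx0_meas : Measurable (x 0)) (hw_meas : ∀ k, Measurable (w k))
    (hv_meas : ∀ k, Measurable (v k)) (hζ_meas : ∀ k, Measurable (ζ k))
    (hx0_law : HasLaw (x 0) (multivariateGaussian 0 Sigma0) P)
    (hw_law : ∀ k, HasLaw (w k) (multivariateGaussian 0 Q) P)
    (hv_law : ∀ k, HasLaw (v k) (multivariateGaussian 0 R) P)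
    (hζ_law : ∀ k, HasLaw (ζ k) (volume.restrict (Set.Icc (0 : ℝ) 1)) P)
    (h_indep : iIndep (sourceSigma (x 0) w v ζ) P)
    (hx : ∀ k ω, x (k + 1) ω = WithLp.toLp 2 (A *ᵥ (x k ω).ofLp) + w k ω)
    (hy : ∀ k ω, y k ω = WithLp.toLp 2 (C *ᵥ (x k ω).ofLp) + v k ω)
    (hγ : ∀ k ω, γ k ω = if ζ k ω ≤ idleProb Y (y k ω) then 0 else 1) (k : ℕ) :
    HasCondDistrib (x k) (info γ y k)
        (gaussianKernel _ (measurable_priorMeanFilter A Q Sigma0 C R Y k)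
          (priorCovFilter A Q Sigma0 C R Y k)) P ∧
      HasCondDistrib (x k) (info γ y (k + 1))
        (gaussianKernel _ (measurable_postMeanFilter A Q Sigma0 C R Y k)
          (postCovFilter A Q Sigma0 C R Y k)) P := by
  have hσ (s : Source) : sourceSigma (x 0) w v ζ s ≤ ‹MeasurableSpace Ω› := by
    cases s
    · exact hx0_meas.comap_le
    · exact (hw_meas _).comap_le
    · exact (hv_meas _).comap_le
    · exact (hζ_meas _).comap_le
  have hle {T : Set Source} {s : Source} (hs : s ∈ T) :
      sourceSigma (x 0) w v ζ s ≤ ⨆ s ∈ T, sourceSigma (x 0) w v ζ s :=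
    le_iSup₂ (f := fun s (_ : s ∈ T) ↦ sourceSigma (x 0) w v ζ s) s hs
  have hxm (k l : ℕ) :
      Measurable[⨆ s ∈ history k l, sourceSigma (x 0) w v ζ s] (x k) :=
    @measurable_state Ω n (⨆ s ∈ history k l, sourceSigma (x 0) w v ζ s) A x w hx
      ((comap_measurable (x 0)).mono (hle (s := .init) trivial) le_rfl) k
      fun j hj ↦ (comap_measurable (w j)).mono (hle (s := .process j) hj) le_rfl
  have hinfo (k l : ℕ) (hl : l ≤ k + 1) :
      Measurable[⨆ s ∈ history k l, sourceSigma (x 0) w v ζ s] (info γ y l) :=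
    @measurable_info Ω n m (⨆ s ∈ history k l, sourceSigma (x 0) w v ζ s) C Y x y v ζ γ hy hγ l
      (fun j hj ↦ (hxm j l).mono (iSup₂_mono' fun s hs ↦ ⟨s, by
        cases s with
        | process i => exact (show i < j from hs).trans_le (by omega)
        | _ => exact hs, le_rfl⟩) le_rfl)
      (fun j hj ↦ (comap_measurable (v j)).mono (hle (s := .measurement j) hj) le_rfl)
      (fun j hj ↦ (comap_measurable (ζ j)).mono (hle (s := .threshold j) hj) le_rfl)
  have hpost (k : ℕ) (h : HasCondDistrib (x k) (info γ y k)
        (gaussianKernel _ (measurable_priorMeanFilter A Q Sigma0 C R Y k)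
          (priorCovFilter A Q Sigma0 C R Y k)) P) :
      HasCondDistrib (x k) (info γ y (k + 1))
        (gaussianKernel _ (measurable_postMeanFilter A Q Sigma0 C R Y k)
          (postCovFilter A Q Sigma0 C R Y k)) P := by
    have hind : IndepFun (fun ω ↦ (info γ y k ω, x k ω)) (fun ω ↦ (v k ω, ζ k ω)) P := by
      refine indepFun_of_measurable_iSup hσ h_indep
        (S := history k k) (T := {.measurement k, .threshold k}) ?_
        ((hinfo k k k.le_succ).prodMk (hxm k k))
        (((comap_measurable (v k)).mono (hle (s := .measurement k) (by simp)) le_rfl).prodMk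
          ((comap_measurable (ζ k)).mono (hle (s := .threshold k) (by simp)) le_rfl))
      rw [Set.disjoint_right]
      rintro s (rfl | rfl) <;> exact lt_irrefl k
    have hvζ : IndepFun (v k) (ζ k) P := by
      refine indepFun_of_measurable_iSup hσ h_indep
        (S := {.measurement k}) (T := {.threshold k}) (by simp)
        ((comap_measurable (v k)).mono (hle (s := .measurement k) rfl) le_rfl)
        ((comap_measurable (ζ k)).mono (hle (s := .threshold k) rfl) le_rfl)
    have hfun : info γ y (k + 1) = (fun p : (Fin k → ℝ × EuclideanSpace ℝ (Fin m)) ×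
          (ℝ × EuclideanSpace ℝ (Fin m)) ↦
        (Fin.snoc p.1 p.2 : Fin (k + 1) → ℝ × EuclideanSpace ℝ (Fin m))) ∘
        fun ω ↦ (info γ y k ω, (γ k ω, γ k ω • y k ω)) := funext (info_succ γ y k)
    rw [hfun]
    refine HasCondDistrib.comp_right (hf := measurable_snoc k) ?_
    refine hasCondDistrib_measurementUpdate h (gaussianKernel_apply _ _ _)
      (posSemidef_priorCovFilter hQ hSigma0 hR hY k) hR hY (hv_law k) (hζ_law k) hind hvζ
      (hy k) (hγ k) fun z g u hg ↦ ?_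
    have hdec : lastDecision m k (Fin.snoc z (g, u)) = g := by
      rw [lastDecision_eq] <;> simp [hg]
    rw [Kernel.comap_apply, gaussianKernel_apply, postMeanFilter, postCovFilter_apply, hdec,
      Fin.init_snoc, Fin.snoc_last]
  suffices hprior : HasCondDistrib (x k) (info γ y k)
        (gaussianKernel _ (measurable_priorMeanFilter A Q Sigma0 C R Y k)
          (priorCovFilter A Q Sigma0 C R Y k)) P from ⟨hprior, hpost k hprior⟩
  induction k with
  | zero =>
    have hκ : gaussianKernel _ (measurable_priorMeanFilter A Q Sigma0 C R Y 0)
        (priorCovFilter A Q Sigma0 C R Y 0) =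
          Kernel.const _ (multivariateGaussian 0 Sigma0) := by
      ext1 z
      rfl
    -- there is no data at time `0`, so conditioning on it is conditioning on a constant
    have hc : info γ y 0 = fun _ ↦ default := funext fun _ ↦ Subsingleton.elim _ _
    refine ⟨by rw [hc]; exact measurable_const.aemeasurable.prodMk hx0_meas.aemeasurable, ?_⟩
    rw [hκ, Measure.compProd_const, ← hx0_law.map_eq, hc]
    exact (indepFun_const_left _ _).map_prod_eq_prod_map_map aemeasurable_const
      hx0_meas.aemeasurable
  | succ k ih =>
    have hind : IndepFun (fun ω ↦ (info γ y (k + 1) ω, x k ω)) (w k) P := by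
      refine indepFun_of_measurable_iSup hσ h_indep
        (S := history k (k + 1)) (T := {.process k}) ?_
        ((hinfo k (k + 1) le_rfl).prodMk (hxm k (k + 1)))
        ((comap_measurable (w k)).mono (hle (s := .process k) rfl) le_rfl)
      rw [Set.disjoint_singleton_right]
      exact lt_irrefl k
    rw [funext (hx k)]
    exact hasCondDistrib_timeUpdate (hpost k ih) (gaussianKernel_apply _ _ _)
      (posSemidef_postCovFilter hQ hSigma0 hR hY k) hQ.posSemidef (hw_law k) hind
      (gaussianKernel_apply _ _ _)

theorem memLp_two_state (hx0_law : HasLaw (x 0) (multivariateGaussian 0 Sigma0) P)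
    (hw_law : ∀ k, HasLaw (w k) (multivariateGaussian 0 Q) P)
    (hx : ∀ k ω, x (k + 1) ω = WithLp.toLp 2 (A *ᵥ (x k ω).ofLp) + w k ω) (k : ℕ) :
    MemLp (x k) 2 P := by
  have hgauss {X : Ω → EuclideanSpace ℝ (Fin n)} {T : Matrix (Fin n) (Fin n) ℝ}
      (h : HasLaw X (multivariateGaussian 0 T) P) : MemLp X 2 P := by
    have := IsGaussian.memLp_two_id (μ := multivariateGaussian 0 T)
    rw [← h.map_eq, memLp_map_measure_iff (by fun_prop) h.aemeasurable] at this
    exact this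
  induction k with
  | zero => exact hgauss hx0_law
  | succ k ih =>
    rw [funext (hx k)]
    exact ((Matrix.toEuclideanCLM (𝕜 := ℝ) A).comp_memLp' ih).add (hgauss (hw_law k))

end States

end OLSET

theorem theorem1 {Ω : Type*} [MeasurableSpace Ω] (P : Measure Ω) [IsProbabilityMeasure P]
    {n m : ℕ}
    (A Q Sigma0 : Matrix (Fin n) (Fin n) ℝ) (C : Matrix (Fin m) (Fin n) ℝ)
    (R Y : Matrix (Fin m) (Fin m) ℝ)
    (hQ : Q.PosDef) (hSigma0 : Sigma0.PosDef) (hR : R.PosDef) (hY : Y.PosDef)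
    (x w : ℕ → Ω → EuclideanSpace ℝ (Fin n)) (y v : ℕ → Ω → EuclideanSpace ℝ (Fin m))
    (ζ γ : ℕ → Ω → ℝ)
    -- initial state, noises and thresholds: laws, measurability, independence
    (hx0_meas : Measurable (x 0)) (hw_meas : ∀ k, Measurable (w k))
    (hv_meas : ∀ k, Measurable (v k)) (hζ_meas : ∀ k, Measurable (ζ k))
    (hx0_law : HasLaw (x 0) (multivariateGaussian 0 Sigma0) P)
    (hw_law : ∀ k, HasLaw (w k) (multivariateGaussian 0 Q) P)
    (hv_law : ∀ k, HasLaw (v k) (multivariateGaussian 0 R) P)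
    (hζ_law : ∀ k, HasLaw (ζ k) (volume.restrict (Set.Icc (0 : ℝ) 1)) P)
    (h_indep : iIndep (OLSET.sourceSigma (x 0) w v ζ) P)
    -- system equations and open-loop scheduler
    (hx : ∀ k ω, x (k + 1) ω = WithLp.toLp 2 (A *ᵥ (x k ω).ofLp) + w k ω)
    (hy : ∀ k ω, y k ω = WithLp.toLp 2 (C *ᵥ (x k ω).ofLp) + v k ω)
    (hγ : ∀ k ω, γ k ω = if ζ k ω ≤ OLSET.idleProb Y (y k ω) then 0 else 1) :
    -- conditional Gaussianity (with square-integrability, so that the conditional moments exist)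
    (∀ k, MemLp (x k) 2 P) ∧
    (∀ k, OLSET.IsCondGaussian P (x k) (OLSET.info γ y k)
      (OLSET.priorMean P x γ y k) (OLSET.priorCov P x γ y k)) ∧
    (∀ k, OLSET.IsCondGaussian P (x k) (OLSET.info γ y (k + 1))
      (OLSET.postMean P x γ y k) (OLSET.postCov P x γ y k)) ∧
    -- recursion
    (∀ᵐ ω ∂P,
      (OLSET.priorMean P x γ y 0 ω = 0 ∧ OLSET.priorCov P x γ y 0 ω = Sigma0) ∧
      (∀ k, OLSET.priorMean P x γ y (k + 1) ω =
          WithLp.toLp 2 (A *ᵥ (OLSET.postMean P x γ y k ω).ofLp)) ∧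
      (∀ k, OLSET.priorCov P x γ y (k + 1) ω = A * OLSET.postCov P x γ y k ω * Aᵀ + Q) ∧
      (∀ k, OLSET.postMean P x γ y k ω =
          WithLp.toLp 2
            ((1 - OLSET.gain C R Y (OLSET.priorCov P x γ y k ω) (γ k ω) * C) *ᵥ
                (OLSET.priorMean P x γ y k ω).ofLp +
              γ k ω • (OLSET.gain C R Y (OLSET.priorCov P x γ y k ω) (γ k ω) *ᵥ
                (y k ω).ofLp))) ∧
      (∀ k, OLSET.postCov P x γ y k ω =
          OLSET.priorCov P x γ y k ω -
            OLSET.gain C R Y (OLSET.priorCov P x γ y k ω) (γ k ω) * C *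
              OLSET.priorCov P x γ y k ω)) := by

  have hS := OLSET.posSemidef_priorCovFilter (A := A) (C := C) hQ hSigma0 hR hY
  have hS' := OLSET.posSemidef_postCovFilter (A := A) (C := C) hQ hSigma0 hR hY
  have hlaw := OLSET.hasCondDistrib_state hQ hSigma0 hR hY hx0_meas hw_meas hv_meas hζ_meas
    hx0_law hw_law hv_law hζ_law h_indep hx hy hγ
  have hL := OLSET.memLp_two_state hx0_law hw_law hx
  have hxm (k : ℕ) : Measurable (x k) :=
    OLSET.measurable_state hx hx0_meas fun j _ ↦ hw_meas j
  have hZ (k : ℕ) : Measurable (OLSET.info γ y k) :=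
    OLSET.measurable_info hy hγ (fun j _ ↦ hxm j) (fun j _ ↦ hv_meas j) (fun j _ ↦ hζ_meas j)
  have hM := OLSET.measurable_priorMeanFilter A Q Sigma0 C R Y
  have hM' := OLSET.measurable_postMeanFilter A Q Sigma0 C R Y
  refine ⟨hL,
    fun k ↦ OLSET.isCondGaussian_condMean_condCov (hxm k) (hZ k) (hL k) (hlaw k).1
      (OLSET.gaussianKernel_apply _ _ _) (hM k) (hS k),
    fun k ↦ OLSET.isCondGaussian_condMean_condCov (hxm k) (hZ (k + 1)) (hL k) (hlaw k).2
      (OLSET.gaussianKernel_apply _ _ _) (hM' k) (hS' k), ?_⟩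
  filter_upwards [
    ae_all_iff.2 fun k ↦ OLSET.condMean_ae_eq (hxm k) (hZ k) (hL k) (hlaw k).1
      (OLSET.gaussianKernel_apply _ _ _),
    ae_all_iff.2 fun k ↦ OLSET.condCov_ae_eq (hxm k) (hZ k) (hL k) (hlaw k).1
      (OLSET.gaussianKernel_apply _ _ _) (hM k) (hS k),
    ae_all_iff.2 fun k ↦ OLSET.condMean_ae_eq (hxm k) (hZ (k + 1)) (hL k) (hlaw k).2
      (OLSET.gaussianKernel_apply _ _ _),
    ae_all_iff.2 fun k ↦ OLSET.condCov_ae_eq (hxm k) (hZ (k + 1)) (hL k) (hlaw k).2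
      (OLSET.gaussianKernel_apply _ _ _) (hM' k) (hS' k)] with ω h1 h2 h3 h4
  have hdec (k : ℕ) : OLSET.lastDecision m k (OLSET.info γ y (k + 1) ω) = γ k ω := by
    refine OLSET.lastDecision_eq ?_
    change γ k ω = 0 ∨ γ k ω = 1
    rw [hγ]
    split_ifs <;> simp
  simp only [OLSET.priorMean, OLSET.priorCov, OLSET.postMean, OLSET.postCov, h1, h2, h3, h4]
  refine ⟨⟨rfl, rfl⟩, fun k ↦ rfl, fun k ↦ rfl, fun k ↦ ?_, fun k ↦ ?_⟩
  · rw [OLSET.postMeanFilter, hdec, OLSET.init_info_succ, OLSET.measMean, ← Matrix.mulVec_smul]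
    rfl
  · rw [OLSET.postCovFilter_apply, hdec, OLSET.init_info_succ, OLSET.measCov]
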